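/- Hypergraphs are finite, their edges are distinct sets of vertices, and a hypergraph is $k$-uniform if every edge has exactly $k$ vertices. A cycle is a sequence $(v_0,e_1,v_1,\dots,e_s,v_s)$ with $s\ge 2$, $v_{i-1},v_i\in e_i$, the edges $e_1,\dots,e_s$ distinct, the vertices $v_0,\dots,v_{s-1}$ distinct, and $v_s=v_0$; sequences that differ only in starting point and direction are the same cycle (so two edges with exactly $t\ge 2$ common vertices form $\binom t2$ cycles of length $2$). A hypertree is a connected hypergraph with no cycle, and a unicyclic hypergraph is a connected hypergraph with exactly one cycle. For a $k$-uniform hypergraph $G$ with $k\ge2$, the adjacency tensor $\mathcal A(G)$ is the tensor of order $k$, indexed by $V(G)$, whose $(i_1,\dots,i_k)$-entry is $\frac1{(k-1)!}$ if $\{i_1,\dots,i_k\}\in E(G)$ and $0$ otherwise, and $\mathcal D(G)$ is the diagonal tensor of order $k$ of the vertex degrees. A complex number $\lambda$ is an eigenvalue of a tensor $\mathcal T$ of order $k$ if there is a nonzero complex vector $x$ with $\sum_{i_2,\dots,i_k}\mathcal T_{ii_2\dots i_k}x_{i_2}\cdots x_{i_k}=\lambda x_i^{k-1}$ for all $i$.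 For $0\le\alpha<1$, $\rho_\alpha(G)$ is the largest modulus of the eigenvalues of $\alpha\mathcal D(G)+(1-\alpha)\mathcal A(G)$. For $m\ge1$ and $k\ge2$, let $S_{m,k}$ be the hyperstar: the $k$-uniform hypertree with $m$ edges that all share a common vertex. For $m\ge2$ and $k\ge3$, let $H_{m,1,k}$ be the $k$-uniform hypergraph with $m$ edges that all share a vertex $w$, in which two of the edges share exactly one further vertex, any other two edges meet only in $w$, and every vertex lies on an edge. Let $k\ge 2$ and $0\le\alpha<1$. (i) Let $m\ge1$. Then $S_{m,k}$ is a $k$-uniform hypertree with $m$ edges, and every $k$-uniform hypertree $G$ with $m$ edges satisfies $\rho_\alpha(G)\le\rho_\alpha(S_{m,k})$, with equality if and only if $G\cong S_{m,k}$. (ii) Let $m\ge2$ and $k\ge3$. Then $H_{m,1,k}$ is a $k$-uniform unicyclic hypergraph with $m$ edges, and every $k$-uniform unicyclic hypergraph $G$ with $m$ edges satisfies $\rho_\alpha(G)\le\rho_\alpha(H_{m,1,k})$, with equality if and only if $G\cong H_{m,1,k}$. -/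

import Mathlib

/-! ## Tensors and their spectral radius -/

/-- Complex tensors of order `k` (for `k ≥ 1`) whose indices run over `ι`: the entry
`T_{i i₂ … i_k}` is `T i j`, where `j = (i₂, …, i_k)`. -/
abbrev HTensor (k : ℕ) (ι : Type*) : Type _ := ι → (Fin (k - 1) → ι) → ℂ

namespace HTensor

variable {k : ℕ} {ι : Type*} [Fintype ι]

/-- The vector `T x` with entries `(T x)_i = ∑_{i₂, …, i_k} T_{i i₂ … i_k} x_{i₂} ⋯ x_{i_k}`. -/
noncomputable def mulVec (T : HTensor k ι) (x : ι → ℂ) : ι → ℂ :=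
  fun i => ∑ j : Fin (k - 1) → ι, T i j * ∏ l, x (j l)

/-- `c` is an eigenvalue of `T` if `T x = c x^{[k-1]}` for some nonzero complex vector `x`. -/
def IsEigenvalue (T : HTensor k ι) (c : ℂ) : Prop :=
  ∃ x : ι → ℂ, x ≠ 0 ∧ ∀ i, T.mulVec x i = c * x i ^ (k - 1)

/-- The spectral radius: the largest modulus of the eigenvalues. -/
noncomputable def spectralRadius (T : HTensor k ι) : ℝ :=
  sSup {r : ℝ | ∃ c : ℂ, T.IsEigenvalue c ∧ r = ‖c‖}

end HTensor

/-! ## Hypergraphs -/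

namespace Hypergraph

section Basic

variable {V : Type*} (G : Hypergraph V)

/-- Every edge has exactly `k` vertices. -/
def IsUniform (k : ℕ) : Prop := ∀ e ∈ G.edgeSet, e.ncard = k

/-- The number of edges containing `v`. -/
noncomputable def degree (v : V) : ℕ := {e ∈ G.edgeSet | v ∈ e}.ncard

/-- `(v₀, e₁, v₁, …, e_s, v_s)` is a walk of length `s` (the edge `e_{i+1}` is `e i` below). -/
def IsWalk (s : ℕ) (v : Fin (s + 1) → V) (e : Fin s → Set V) : Prop :=
  v 0 ∈ G.vertexSet ∧ ∀ i : Fin s, e i ∈ G.edgeSet ∧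
    v i.castSucc ∈ e i ∧ v i.succ ∈ e i ∧ v i.castSucc ≠ v i.succ

/-- A path is a walk whose vertices are distinct and whose edges are distinct. -/
def IsPath (s : ℕ) (v : Fin (s + 1) → V) (e : Fin s → Set V) : Prop :=
  G.IsWalk s v e ∧ Function.Injective v ∧ Function.Injective e

/-- A cycle is a walk with at least two edges, whose edges are distinct and whose vertices are
distinct except that `v₀ = v_s`. -/
def IsCycle (s : ℕ) (v : Fin (s + 1) → V) (e : Fin s → Set V) : Prop :=
  G.IsWalk s v e ∧ 2 ≤ s ∧ Function.Injective e ∧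
    Function.Injective (fun i : Fin s => v i.castSucc) ∧ v 0 = v (Fin.last s)

/-- Any two vertices are joined by a path. -/
def IsConnected : Prop :=
  ∀ u ∈ G.vertexSet, ∀ w ∈ G.vertexSet,
    ∃ (s : ℕ) (v : Fin (s + 1) → V) (e : Fin s → Set V),
      G.IsPath s v e ∧ v 0 = u ∧ v (Fin.last s) = w

/-- The cycles of `G`, where two cyclic sequences that differ only in the starting point and the
direction are the same cycle. To identify them, a cycle is recorded as the set of the incidences
(vertex, edge) that it runs through, that is, as a cycle subgraph of the incidence graph. -/
def cycles : Set (Set (V × Set V)) :=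
  {C | ∃ (s : ℕ) (v : Fin (s + 1) → V) (e : Fin s → Set V), G.IsCycle s v e ∧
    C = {p | ∃ i : Fin s, p = (v i.castSucc, e i) ∨ p = (v i.succ, e i)}}

/-- A hypertree is a connected hypergraph with no cycles. -/
def IsHypertree : Prop :=
  G.IsConnected ∧ ∀ (s : ℕ) (v : Fin (s + 1) → V) (e : Fin s → Set V), ¬ G.IsCycle s v e

/-- A unicyclic hypergraph is a connected hypergraph with exactly one cycle. -/
def IsUnicyclic : Prop := G.IsConnected ∧ ∃! C, C ∈ G.cycles

/-- Isomorphism: a bijection of the vertex sets that carries edges to edges, both ways. -/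
def Isomorphic {W : Type*} (G : Hypergraph V) (H : Hypergraph W) : Prop :=
  ∃ φ : G.vertexSet ≃ H.vertexSet, ∀ s : Set G.vertexSet,
    Subtype.val '' s ∈ G.edgeSet ↔ Subtype.val '' (φ '' s) ∈ H.edgeSet

open Classical in
/-- The adjacency tensor of a `k`-uniform hypergraph: the entry at `(i₁, …, i_k)` is `1 / (k-1)!`
if `{i₁, …, i_k}` is an edge and `0` otherwise. -/
noncomputable def adjacencyTensor (k : ℕ) : HTensor k G.vertexSet :=
  fun i j => if insert (i : V) (Set.range fun l => (j l : V)) ∈ G.edgeSet then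
    1 / ((k - 1).factorial : ℂ) else 0

open Classical in
/-- The diagonal tensor of the degrees. -/
noncomputable def degreeTensor (k : ℕ) : HTensor k G.vertexSet :=
  fun i j => if ∀ l, j l = i then (G.degree i : ℂ) else 0

/-- The tensor `𝒜_α(G) = α 𝒟(G) + (1 - α) 𝒜(G)`. -/
noncomputable def alphaTensor (k : ℕ) (α : ℝ) : HTensor k G.vertexSet :=
  (α : ℂ) • G.degreeTensor k + (1 - α : ℂ) • G.adjacencyTensor k

/-- The `α`-spectral radius `ρ_α(G)` of a `k`-uniform hypergraph `G`. -/
noncomputable def alphaSpectralRadius [Fintype G.vertexSet] (k : ℕ) (α : ℝ) : ℝ :=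
  (G.alphaTensor k α).spectralRadius

end Basic

/-! ## The extremal hypergraphs -/

/-- The hyperstar `S_{m,k}`: the center `none` lies on all of the `m` edges, and the `i`-th edge has
`k - 1` further vertices `some (i, j)` of its own. -/
def hyperstar (m k : ℕ) : Hypergraph (Option (Fin m × Fin (k - 1))) where
  vertexSet := Set.univ
  edgeSet := Set.range fun i : Fin m =>
    insert none (Set.range fun j : Fin (k - 1) => some (i, j))
  subset_vertexSet_of_mem_edgeSet' := fun _ _ => Set.subset_univ _

/-- The vertices of `H_{m,r,k}`: a center, for each of the `r` cycles of length `2` a second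
common vertex of its two edges and `k - 2` further vertices on each of these, and `k - 1`
further vertices on each of the `m - 2 r` pendant edges. -/
abbrev CyclicStarVertex (m r k : ℕ) : Type :=
  Unit ⊕ Fin r ⊕ (Fin r × Fin 2 × Fin (k - 2)) ⊕ (Fin (m - 2 * r) × Fin (k - 1))

namespace CyclicStarVertex

variable {m r k : ℕ}

/-- The vertex common to all edges. -/
def center : CyclicStarVertex m r k := Sum.inl ()

/-- The second common vertex of the two edges of the `c`-th cycle. -/
def second (c : Fin r) : CyclicStarVertex m r k := Sum.inr (Sum.inl c)

/-- The `j`-th vertex of degree one on the `b`-th edge of the `c`-th cycle. -/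
def onCycle (c : Fin r) (b : Fin 2) (j : Fin (k - 2)) : CyclicStarVertex m r k :=
  Sum.inr (Sum.inr (Sum.inl (c, b, j)))

/-- The `j`-th vertex of degree one on the `i`-th pendant edge. -/
def onPendant (i : Fin (m - 2 * r)) (j : Fin (k - 1)) : CyclicStarVertex m r k :=
  Sum.inr (Sum.inr (Sum.inr (i, j)))

end CyclicStarVertex

open CyclicStarVertex in
/-- The hypergraph `H_{m,r,k}` (for `2 r ≤ m` and `k ≥ 3`), which consists of `r` cycles of length
`2` and `m - 2 r` pendant edges with a vertex in common. -/
def cyclicStar (m r k : ℕ) : Hypergraph (CyclicStarVertex m r k) where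
  vertexSet := Set.univ
  edgeSet :=
    (Set.range fun p : Fin r × Fin 2 => {center, second p.1} ∪ Set.range (onCycle p.1 p.2)) ∪
    (Set.range fun i : Fin (m - 2 * r) => {center} ∪ Set.range (onPendant i))
  subset_vertexSet_of_mem_edgeSet' := fun _ _ => Set.subset_univ _

instance (m k : ℕ) : Fintype (hyperstar m k).vertexSet :=
  inferInstanceAs (Fintype (Set.univ : Set (Option (Fin m × Fin (k - 1)))))

instance (m r k : ℕ) : Fintype (cyclicStar m r k).vertexSet :=
  inferInstanceAs (Fintype (Set.univ : Set (CyclicStarVertex m r k)))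

end Hypergraph

set_option linter.unusedSectionVars false

/-! Put β = α/(1-α). Suppose that every incidence (v,e) carries a label b(v,e) > 0, that the labels
on each edge have product at least 1, and that at each vertex the numbers b + β sum to q + β.
Weighted AM-GM on the edges then bounds the modulus of every eigenvalue by (1-α)q + α
(`EigenEq.norm_le`); if a connected hypergraph attains this bound, all edge products equal 1. For
the extremal hypergraphs an explicit positive eigenvector shows that the bound is the exact value.
It remains to label every competitor with the same q, and to see that edge products equal to 1 force
the extremal shape.

In the hyperstar the centre has label p on each edge and all other vertices have label q, where p
q^(k-1) = 1 and m(p+β) = q+β. For a hypertree, root the incidence tree at an edge. With g = p+β,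
each vertex spends g on every edge below it, through the child edge leading there, and keeps the
rest for its parent edge. If t is g times the number of edges strictly below a non-root edge, the
product there is (p+t)∏(q-x_v) with ∑ x_v = t. By the Weierstrass product inequality it is at least
q^(k-2)(p+t)(q-t), and this is at least p q^(k-1) = 1 because 0 ≤ t ≤ q-p. The root edge is similar
with t = q-p. Equality leaves no edge below a non-root edge and lets only one vertex of the root
edge carry branches: a hyperstar (`exists_labels_of_tree`).

For a unicyclic hypergraph, remove one incidence (v₁,e₀) of the cycle. The rest is a tree, rooted at
e₀, and the cycle is its path from e₀ to v₁ closed up by the removed incidence. In H_{m,1,k} the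
centre has label p' on the two cycle edges and the second common vertex has label (q-β)/2 there.
Accordingly v₁ splits what its branches leave equally between its two cycle edges, and a correction
δ is passed along the path without changing the vertex sums. Edges inside the path get product
greater than 1, so tightness forces a cycle of length 2; on its two edges tightness puts all other
branches at a single vertex (`exists_labels_of_unicyclic`). -/

namespace Hypergraph

/-! ### Incidence labels and the AM-GM bound for eigenvalues -/

section Incidence

variable {V E : Type*} [Fintype V] [Fintype E] [DecidableEq V]

/-- The eigenvalue equations of the `α`-tensor, for the edges `I e`, in terms of edges. -/
def EigenEq (I : E → Finset V) (k : ℕ) (α : ℝ) (c : ℂ) (y : V → ℂ) : Prop :=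
  ∀ v, (α : ℂ) * (Finset.univ.filter fun e => v ∈ I e).card * y v ^ (k - 1) +
    (1 - α : ℂ) * ∑ e with v ∈ I e, ∏ u ∈ (I e).erase v, y u = c * y v ^ (k - 1)

lemma sum_incidence (I : E → Finset V) (f : V → E → ℝ) :
    ∑ v, ∑ e with v ∈ I e, f v e = ∑ e, ∑ v ∈ I e, f v e := by
  simp only [Finset.sum_filter]
  rw [Finset.sum_comm]
  refine Finset.sum_congr rfl fun e _ => ?_
  rw [← Finset.sum_filter]
  congr 1
  ext v; simp

omit [Fintype V] [DecidableEq V] in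
lemma card_pow_mul_prod_le_sum_pow (A : Finset V) {k : ℕ} (hk : 1 ≤ k) (hA : A.card = k)
    (z : V → ℝ) (hz : ∀ v ∈ A, 0 ≤ z v) :
    (k : ℝ) ^ k * ∏ v ∈ A, z v ≤ (∑ v ∈ A, z v) ^ k := by
  have hk0 : (0 : ℝ) < k := by exact_mod_cast hk
  have h := Real.geom_mean_le_arith_mean A (fun _ => 1) z (fun _ _ => zero_le_one)
    (by simp [hA]; omega) hz
  simp only [Real.rpow_one, Finset.sum_const, hA, nsmul_eq_mul, mul_one, one_mul] at h
  have hp : 0 ≤ ∏ v ∈ A, z v := Finset.prod_nonneg hz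
  have h2 := pow_le_pow_left₀ (Real.rpow_nonneg hp _) h k
  rw [← Real.rpow_natCast, ← Real.rpow_mul hp, inv_mul_cancel₀ hk0.ne', Real.rpow_one, div_pow,
    le_div_iff₀ (by positivity)] at h2
  linarith

omit [Fintype V] [DecidableEq V] in
/-- AM-GM with weights `b v` of product at least one. -/
lemma card_mul_prod_le (A : Finset V) {k : ℕ} (hk : 1 ≤ k) (hA : A.card = k) (b t : V → ℝ)
    (hb : ∀ v ∈ A, 0 < b v) (ht : ∀ v, 0 ≤ t v) (hprod : 1 ≤ ∏ v ∈ A, b v) :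
    (k : ℝ) * ∏ v ∈ A, t v ≤ ∑ v ∈ A, b v * t v ^ k ∧
    ((k : ℝ) * ∏ v ∈ A, t v = ∑ v ∈ A, b v * t v ^ k → 0 < ∏ v ∈ A, t v →
      ∏ v ∈ A, b v = 1) := by
  have hk0 : (0 : ℝ) < k := by exact_mod_cast hk
  have hz : ∀ v ∈ A, 0 ≤ b v * t v ^ k := fun v hv =>
    mul_nonneg (hb v hv).le (pow_nonneg (ht v) _)
  have key : (∏ v ∈ A, b v) * ((k : ℝ) * ∏ v ∈ A, t v) ^ k ≤ (∑ v ∈ A, b v * t v ^ k) ^ k := by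
    refine le_of_eq_of_le ?_ (card_pow_mul_prod_le_sum_pow A hk hA _ hz)
    rw [Finset.prod_mul_distrib, Finset.prod_pow]
    ring
  have hP : 0 ≤ ∏ v ∈ A, t v := Finset.prod_nonneg fun v _ => ht v
  refine ⟨?_, fun h h0 => ?_⟩
  · refine le_of_pow_le_pow_left₀ (by omega : k ≠ 0) (Finset.sum_nonneg hz) (le_trans ?_ key)
    exact le_mul_of_one_le_left (by positivity) hprod
  · rw [← h] at key
    have : 0 < ((k : ℝ) * ∏ v ∈ A, t v) ^ k := by positivity
    exact le_antisymm (le_of_mul_le_mul_right (by linarith) this) hprod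

/-- Take moduli t in the eigenvalue equations, multiply the one at v by t v and sum over v: each
edge product then occurs k times, and AM-GM with weights b replaces k∏t by ∑ b t^k. Equality
throughout means equality on each edge, and there AM-GM forces weight product 1 as soon as t does
not vanish on the edge. The closure condition on sets S is connectedness in the form needed to see
that t vanishes nowhere. -/
theorem EigenEq.norm_le {I : E → Finset V} {k : ℕ} (hk : 1 ≤ k) (hcard : ∀ e, (I e).card = k)
    {α : ℝ} (hα0 : 0 ≤ α) (hα1 : α < 1) {b : V → E → ℝ} (hb : ∀ e, ∀ v ∈ I e, 0 < b v e)
    (hprod : ∀ e, 1 ≤ ∏ v ∈ I e, b v e) {r : ℝ}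
    (hsum : ∀ v, α * (Finset.univ.filter fun e => v ∈ I e).card +
      (1 - α) * ∑ e with v ∈ I e, b v e ≤ r)
    {c : ℂ} {y : V → ℂ} (hy : y ≠ 0) (h : EigenEq I k α c y) :
    ‖c‖ ≤ r ∧ (‖c‖ = r →
      (∀ S : Set V, S.Nonempty → (∀ e, ∀ u ∈ I e, ∀ v ∈ I e, u ∈ S → v ∈ S) → S = Set.univ) →
      ∀ e, ∏ v ∈ I e, b v e = 1) := by
  set t : V → ℝ := fun v => ‖y v‖ with ht
  have ht0 : ∀ v, 0 ≤ t v := fun v => norm_nonneg _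
  set P : E → ℝ := fun e => ∏ v ∈ I e, t v with hP
  have hP0 : ∀ e, 0 ≤ P e := fun e => Finset.prod_nonneg fun v _ => ht0 v
  have hα : 0 < 1 - α := by linarith
  have key (v : V) : ‖c‖ * t v ^ k ≤
      α * (Finset.univ.filter fun e => v ∈ I e).card * t v ^ k +
        (1 - α) * ∑ e with v ∈ I e, P e := by
    have h1 : ‖c‖ * t v ^ (k - 1) ≤ α * (Finset.univ.filter fun e => v ∈ I e).card *
        t v ^ (k - 1) + (1 - α) * ∑ e with v ∈ I e, ∏ u ∈ (I e).erase v, t u := by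
      rw [ht]
      simp only
      rw [← norm_pow, ← norm_mul, ← h v]
      refine (norm_add_le _ _).trans (add_le_add (le_of_eq ?_) ?_)
      · rw [norm_mul, norm_mul, norm_pow, Complex.norm_of_nonneg hα0, Complex.norm_natCast]
      · rw [norm_mul, show (1 - α : ℂ) = ((1 - α : ℝ) : ℂ) by push_cast; rfl,
          Complex.norm_of_nonneg hα.le]
        refine mul_le_mul_of_nonneg_left ((norm_sum_le _ _).trans (le_of_eq ?_)) hα.le
        simp only [norm_prod]
    -- Multiplying by t v restores the missing factor of each edge product and stays valid where t v
    -- = 0.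
    have h2 := mul_le_mul_of_nonneg_left h1 (ht0 v)
    have hpow : t v ^ k = t v * t v ^ (k - 1) := by
      rw [← pow_succ', Nat.sub_add_cancel hk]
    have h3 : ∑ e with v ∈ I e, P e = t v * ∑ e with v ∈ I e, ∏ u ∈ (I e).erase v, t u := by
      rw [Finset.mul_sum]
      refine Finset.sum_congr rfl fun e he => ?_
      rw [Finset.mul_prod_erase _ _ (by simpa using he)]
    rw [h3, hpow]
    calc _ = t v * (‖c‖ * t v ^ (k - 1)) := by ring
      _ ≤ _ := h2
      _ = _ := by ring
  have amgm (e : E) := card_mul_prod_le (I e) hk (hcard e) (fun v => b v e) t (hb e) ht0 (hprod e)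
  have total1 : ‖c‖ * ∑ v, t v ^ k ≤
      ∑ v, α * (Finset.univ.filter fun e => v ∈ I e).card * t v ^ k +
        (1 - α) * ∑ e, (k : ℝ) * P e := by
    have h4 : ∑ e, (k : ℝ) * P e = ∑ v, ∑ e with v ∈ I e, P e := by
      rw [sum_incidence]
      refine Finset.sum_congr rfl fun e _ => ?_
      rw [Finset.sum_const, hcard, nsmul_eq_mul]
    rw [h4, Finset.mul_sum, Finset.mul_sum, ← Finset.sum_add_distrib]
    exact Finset.sum_le_sum fun v _ => key v
  have total2 : ∑ v, α * (Finset.univ.filter fun e => v ∈ I e).card * t v ^ k +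
        (1 - α) * ∑ e, ∑ v ∈ I e, b v e * t v ^ k ≤ r * ∑ v, t v ^ k := by
    rw [← sum_incidence, Finset.mul_sum, Finset.mul_sum, ← Finset.sum_add_distrib]
    refine Finset.sum_le_sum fun v _ => ?_
    rw [← Finset.sum_mul, ← mul_assoc, ← add_mul]
    exact mul_le_mul_of_nonneg_right (hsum v) (pow_nonneg (ht0 v) _)
  have hmid : ∑ e, (k : ℝ) * P e ≤ ∑ e, ∑ v ∈ I e, b v e * t v ^ k :=
    Finset.sum_le_sum fun e _ => (amgm e).1
  obtain ⟨v0, hv0⟩ : ∃ v, y v ≠ 0 := Function.ne_iff.mp hy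
  have hpos : 0 < ∑ v, t v ^ k :=
    Finset.sum_pos' (fun v _ => pow_nonneg (ht0 v) _)
      ⟨v0, Finset.mem_univ _, pow_pos (norm_pos_iff.mpr hv0) _⟩
  have hmid' := mul_le_mul_of_nonneg_left hmid hα.le
  refine ⟨le_of_mul_le_mul_right (by linarith) hpos, fun hc hconn => ?_⟩
  rw [hc] at total1
  have hsumeq : ∑ e, (k : ℝ) * P e = ∑ e, ∑ v ∈ I e, b v e * t v ^ k :=
    le_antisymm hmid (le_of_mul_le_mul_left (by linarith) hα)
  have heq : ∀ e, (k : ℝ) * P e = ∑ v ∈ I e, b v e * t v ^ k := fun e =>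
    (Finset.sum_eq_sum_iff_of_le fun e _ => (amgm e).1).mp hsumeq e (Finset.mem_univ _)
  -- The support of t contains every edge it meets: if an edge product vanished, equality in AM-GM
  -- would make every term b t^k on that edge vanish.
  have hS : {v | t v ≠ 0} = Set.univ := by
    refine hconn _ ⟨v0, (norm_pos_iff.mpr hv0).ne'⟩ fun e u hu v hv hu0 => ?_
    have hPe : P e ≠ 0 := by
      intro hPe
      have h5 := heq e
      rw [hPe, mul_zero] at h5
      have h6 := (Finset.sum_eq_zero_iff_of_nonneg fun v hv =>
        mul_nonneg (hb e v hv).le (pow_nonneg (ht0 v) k)).mp h5.symm u hu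
      rcases mul_eq_zero.mp h6 with h7 | h7
      · exact (hb e u hu).ne' h7
      · exact hu0 (pow_eq_zero_iff (by omega) |>.mp h7)
    exact Finset.prod_ne_zero_iff.mp hPe v hv
  intro e
  refine (amgm e).2 (heq e) (Finset.prod_pos fun v _ => lt_of_le_of_ne (ht0 v) (Ne.symm ?_))
  have : v ∈ {v | t v ≠ 0} := hS ▸ Set.mem_univ v
  exact this

end Incidence

end Hypergraph

namespace Hypergraph

/-! ### The tensor eigenvalue equations in terms of edges -/

section Tensor

/-- The number of enumerations of a finite set of `n` elements is `n!`. -/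
lemma card_enumerations {W : Type*} [Fintype W] [DecidableEq W] {n : ℕ} (A : Finset W)
    (hA : A.card = n) :
    (Finset.univ.filter fun j : Fin n → W => Finset.univ.image j = A).card = n.factorial := by
  rw [← Fintype.card_subtype]
  have hc : Fintype.card (Fin n ≃ A) = n.factorial := by
    rw [Fintype.card_equiv (Fintype.equivOfCardEq (by simp [hA])), Fintype.card_fin]
  rw [← hc]
  symm
  refine Fintype.card_of_bijective (f := fun f : Fin n ≃ A =>
    (⟨fun l => (f l : W), ?_⟩ : {j : Fin n → W // Finset.univ.image j = A})) ⟨?_, ?_⟩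
  · ext w
    simp only [Finset.mem_image, Finset.mem_univ, true_and]
    refine ⟨fun ⟨l, hl⟩ => hl ▸ (f l).2, fun hw => ⟨f.symm ⟨w, hw⟩, by simp⟩⟩
  · intro f g hfg
    ext l
    exact congrFun (congrArg Subtype.val hfg) l
  · rintro ⟨j, hj⟩
    have hmem : ∀ l, j l ∈ A := fun l => hj ▸ Finset.mem_image_of_mem _ (Finset.mem_univ _)
    have hinj : Function.Injective j := by
      have h : Set.InjOn j (Finset.univ : Finset (Fin n)) :=
        Finset.card_image_iff.mp (by rw [hj, hA]; simp)
      exact fun a b hab => h (by simp) (by simp) hab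
    refine ⟨Equiv.ofBijective (fun l => ⟨j l, hmem l⟩) ⟨fun a b hab => hinj (by simpa using hab),
      fun ⟨w, hw⟩ => ?_⟩, rfl⟩
    rw [← hj] at hw
    obtain ⟨l, -, hl⟩ := Finset.mem_image.mp hw
    exact ⟨l, Subtype.ext hl⟩

lemma sum_enumerations {W : Type*} [Fintype W] [DecidableEq W] {n : ℕ} (A : Finset W)
    (hA : A.card = n) (y : W → ℂ) :
    ∑ j : Fin n → W with Finset.univ.image j = A, ∏ l, y (j l) =
      n.factorial * ∏ u ∈ A, y u := by
  rw [Finset.sum_congr rfl (g := fun _ => ∏ u ∈ A, y u), Finset.sum_const, card_enumerations A hA,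
    nsmul_eq_mul]
  intro j hj
  have hj' := (Finset.mem_filter.mp hj).2
  have hinj : Function.Injective j := by
    have h : Set.InjOn j (Finset.univ : Finset (Fin n)) :=
      Finset.card_image_iff.mp (by rw [hj', hA]; simp)
    exact fun a b hab => h (by simp) (by simp) hab
  rw [← hj', Finset.prod_image fun a _ b _ h => hinj h]

variable {V : Type*} (G : Hypergraph V)

open Classical in
/-- The set of vertices of an edge. -/
noncomputable def ends [Fintype G.vertexSet] (e : G.edgeSet) : Finset G.vertexSet :=
  Finset.univ.filter fun v => (v : V) ∈ (e : Set V)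

variable [Fintype G.vertexSet]

@[simp]
lemma mem_ends {e : G.edgeSet} {v : G.vertexSet} : v ∈ G.ends e ↔ (v : V) ∈ (e : Set V) := by
  simp [ends]

lemma coe_image_ends (e : G.edgeSet) : Subtype.val '' (G.ends e : Set G.vertexSet) = e := by
  ext v
  simp only [Set.mem_image, Finset.mem_coe, mem_ends]
  exact ⟨fun ⟨a, ha, h⟩ => h ▸ ha, fun h => ⟨⟨v, G.mem_vertexSet_of_mem_edgeSet e.2 h⟩, h, rfl⟩⟩

lemma card_ends {k : ℕ} (hG : G.IsUniform k) (e : G.edgeSet) : (G.ends e).card = k := by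
  rw [← hG e e.2, ← G.coe_image_ends e, Set.ncard_image_of_injective _ Subtype.val_injective,
    Set.ncard_coe_finset]

lemma ends_injective : Function.Injective G.ends := fun e f h => by
  rw [Subtype.ext_iff, ← G.coe_image_ends e, ← G.coe_image_ends f, h]

lemma finite_edgeSet : G.edgeSet.Finite := by
  refine Set.Finite.subset (Set.Finite.powerset (Set.toFinite G.vertexSet)) fun e he => ?_
  exact G.subset_vertexSet_of_mem_edgeSet he

variable [Fintype G.edgeSet]

open Classical in
lemma degree_eq_card (v : G.vertexSet) :
    G.degree v = (Finset.univ.filter fun e : G.edgeSet => v ∈ G.ends e).card := by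
  rw [degree, ← Set.ncard_coe_finset, ← Set.ncard_image_of_injective _ Subtype.val_injective]
  congr 1
  ext e
  simp [and_comm]

-- An edge has k elements, so k indices that cover it cannot repeat: the k - 1 indices j must
-- enumerate the edge without i. This is where repeated indices are seen to contribute nothing.
omit [Fintype G.edgeSet] in
open Classical in
lemma insert_range_eq_iff {k : ℕ} (hG : G.IsUniform k) (e : G.edgeSet)
    (i : G.vertexSet) (j : Fin (k - 1) → G.vertexSet) :
    insert (i : V) (Set.range fun l => (j l : V)) = e ↔
      i ∈ G.ends e ∧ Finset.univ.image j = (G.ends e).erase i := by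
  have h1 : insert (i : V) (Set.range fun l => (j l : V)) =
      Subtype.val '' ((insert i (Finset.univ.image j) : Finset G.vertexSet) : Set G.vertexSet) := by
    ext v
    simp only [Set.mem_insert_iff, Set.mem_range, Finset.coe_insert, Finset.coe_image,
      Finset.coe_univ, Set.image_univ, Set.image_insert_eq, Set.mem_image]
    refine or_congr Iff.rfl ⟨fun ⟨l, hl⟩ => ⟨_, ⟨l, rfl⟩, hl⟩, ?_⟩
    rintro ⟨_, ⟨l, rfl⟩, hl⟩
    exact ⟨l, hl⟩
  rw [h1, ← G.coe_image_ends e, Subtype.val_injective.image_injective.eq_iff, Finset.coe_inj]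
  constructor
  · intro h
    have hi : i ∈ G.ends e := h ▸ Finset.mem_insert_self _ _
    refine ⟨hi, (Finset.eq_of_subset_of_card_le ?_ ?_).symm⟩
    · intro v hv
      have := Finset.mem_of_mem_erase hv
      rw [← h] at this
      exact (Finset.mem_insert.mp this).resolve_left (Finset.ne_of_mem_erase hv)
    · rw [Finset.card_erase_of_mem hi, G.card_ends hG]
      exact Finset.card_image_le.trans (by simp)
  · rintro ⟨hi, h⟩
    rw [h, Finset.insert_erase hi]

-- Each edge at i arises from (k-1)! index tuples, which cancels the normalization 1/(k-1)! of the
-- entries.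
open Classical in
lemma adjacencyTensor_mulVec {k : ℕ} (hG : G.IsUniform k) (y : G.vertexSet → ℂ)
    (i : G.vertexSet) : (G.adjacencyTensor k).mulVec y i =
      ∑ e with i ∈ G.ends e, ∏ u ∈ (G.ends e).erase i, y u := by
  have hf : ((k - 1).factorial : ℂ) ≠ 0 := by exact_mod_cast (k - 1).factorial_ne_zero
  have h1 (j : Fin (k - 1) → G.vertexSet) : G.adjacencyTensor k i j * ∏ l, y (j l) =
      ∑ e : G.edgeSet, if i ∈ G.ends e ∧ Finset.univ.image j = (G.ends e).erase i then
        1 / ((k - 1).factorial : ℂ) * ∏ l, y (j l) else 0 := by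
    simp only [← G.insert_range_eq_iff hG]
    unfold adjacencyTensor
    split_ifs with h
    · rw [Finset.sum_eq_single ⟨_, h⟩]
      · simp
      · intro e _ he
        rw [if_neg fun h' => he (Subtype.ext h'.symm)]
      · simp
    · rw [zero_mul, Finset.sum_eq_zero]
      intro e _
      exact if_neg fun h' => h (by rw [h']; exact e.2)
  unfold HTensor.mulVec
  simp only [h1]
  rw [Finset.sum_comm, Finset.sum_filter]
  refine Finset.sum_congr rfl fun e _ => ?_
  split_ifs with hi
  · simp only [hi, true_and]
    rw [← Finset.sum_filter, ← Finset.mul_sum, sum_enumerations, ← mul_assoc,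
      one_div_mul_cancel hf, one_mul]
    rw [Finset.card_erase_of_mem hi, G.card_ends hG]
  · simp [hi]

open Classical in
lemma degreeTensor_mulVec {k : ℕ} (y : G.vertexSet → ℂ) (i : G.vertexSet) :
    (G.degreeTensor k).mulVec y i =
      (Finset.univ.filter fun e : G.edgeSet => i ∈ G.ends e).card * y i ^ (k - 1) := by
  unfold HTensor.mulVec degreeTensor
  rw [Finset.sum_eq_single fun _ => i]
  · simp [degree_eq_card]
  · intro j _ hj
    rw [if_neg fun h => hj (funext h), zero_mul]
  · simp

open Classical in
lemma isEigenvalue_alphaTensor_iff {k : ℕ} (hG : G.IsUniform k) (α : ℝ) (c : ℂ) :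
    (G.alphaTensor k α).IsEigenvalue c ↔ ∃ y, y ≠ 0 ∧ EigenEq G.ends k α c y := by
  refine exists_congr fun y => and_congr Iff.rfl (forall_congr' fun v => ?_)
  rw [show (G.alphaTensor k α).mulVec y v = (α : ℂ) * (G.degreeTensor k).mulVec y v +
    (1 - α : ℂ) * (G.adjacencyTensor k).mulVec y v by
      simp only [HTensor.mulVec, Finset.mul_sum, ← Finset.sum_add_distrib]
      refine Finset.sum_congr rfl fun j _ => ?_
      simp only [alphaTensor, Pi.add_apply, Pi.smul_apply, smul_eq_mul]
      ring]
  rw [G.adjacencyTensor_mulVec hG, G.degreeTensor_mulVec, mul_assoc]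

end Tensor

end Hypergraph

/-! ### Attainment of the spectral radius -/

namespace HTensor

variable {k : ℕ} {ι : Type*} [Fintype ι]

/-- A tensor whose eigenvalues are bounded and which has one attains its spectral radius. -/
lemma exists_isEigenvalue_of_bounded (T : HTensor k ι) {B : ℝ}
    (hB : ∀ c, T.IsEigenvalue c → ‖c‖ ≤ B) (hne : ∃ c, T.IsEigenvalue c) :
    ∃ c, T.IsEigenvalue c ∧ ‖c‖ = T.spectralRadius := by
  have hmul (i : ι) : Continuous fun x : ι → ℂ => T.mulVec x i := by
    unfold HTensor.mulVec
    fun_prop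
  have hclosed : IsClosed {p : ℂ × (ι → ℂ) | ∀ i, T.mulVec p.2 i = p.1 * p.2 i ^ (k - 1)} := by
    rw [Set.ofPred_forall]
    refine isClosed_iInter fun i => isClosed_eq ((hmul i).comp continuous_snd) ?_
    fun_prop
  -- K is the set of eigenpairs with unit eigenvector. The equations are homogeneous, so every
  -- eigenvalue occurs in K, and K is compact because the eigenvalues are bounded.
  obtain ⟨K, hK⟩ : ∃ K : Set (ℂ × (ι → ℂ)), K = (Metric.closedBall 0 B ×ˢ Metric.sphere 0 1) ∩
    {p | ∀ i, T.mulVec p.2 i = p.1 * p.2 i ^ (k - 1)} := ⟨_, rfl⟩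
  have hcomp : IsCompact K := by
    rw [hK]
    exact ((isCompact_closedBall _ _).prod (isCompact_sphere _ _)).inter_right hclosed
  have hnorm (c : ℂ) (hc : T.IsEigenvalue c) : ∃ x, (c, x) ∈ K := by
    obtain ⟨x, hx, h⟩ := hc
    have hx' : ‖x‖ ≠ 0 := norm_ne_zero_iff.mpr hx
    refine ⟨((‖x‖⁻¹ : ℝ) : ℂ) • x, hK ▸ ⟨⟨?_, ?_⟩, fun i => ?_⟩⟩
    · simpa using hB c ⟨x, hx, h⟩
    · simp only [mem_sphere_zero_iff_norm, norm_smul, Complex.norm_real, norm_inv, norm_norm]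
      exact inv_mul_cancel₀ hx'
    · have h1 : T.mulVec (((‖x‖⁻¹ : ℝ) : ℂ) • x) i =
          ((‖x‖⁻¹ : ℝ) : ℂ) ^ (k - 1) * T.mulVec x i := by
        simp only [HTensor.mulVec, Pi.smul_apply, smul_eq_mul, Finset.prod_mul_distrib,
          Finset.prod_const, Finset.card_univ, Fintype.card_fin, Finset.mul_sum]
        exact Finset.sum_congr rfl fun j _ => by ring
      simp only [h1, h i, Pi.smul_apply, smul_eq_mul]
      ring
  have hback (p : ℂ × (ι → ℂ)) (hp : p ∈ K) : T.IsEigenvalue p.1 := by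
    rw [hK] at hp
    refine ⟨p.2, fun h0 => ?_, hp.2⟩
    have := hp.1.2
    rw [h0] at this
    simp at this
  obtain ⟨c0, hc0⟩ := hne
  obtain ⟨x0, hx0⟩ := hnorm c0 hc0
  obtain ⟨p, hp, hmax⟩ := hcomp.exists_isMaxOn ⟨_, hx0⟩
    (f := fun p : ℂ × (ι → ℂ) => ‖p.1‖) (by fun_prop)
  refine ⟨p.1, hback p hp, ?_⟩
  refine (IsGreatest.csSup_eq (s := {r : ℝ | ∃ c : ℂ, T.IsEigenvalue c ∧ r = ‖c‖})
    ⟨⟨p.1, hback p hp, rfl⟩, ?_⟩).symm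
  rintro _ ⟨c, hc, rfl⟩
  obtain ⟨x, hx⟩ := hnorm c hc
  exact hmax hx

end HTensor

namespace Hypergraph

/-! ### Upper bounds and exact values of the α-spectral radius -/

section SpectralRadius

variable {V : Type*} (G : Hypergraph V) [Fintype G.vertexSet] [Fintype G.edgeSet]

omit [Fintype G.edgeSet] in
/-- In a connected hypergraph, a nonempty set of vertices that contains each edge it meets is the
whole vertex set. -/
lemma IsConnected.eq_univ {G : Hypergraph V} [Fintype G.vertexSet] (hG : G.IsConnected)
    (S : Set G.vertexSet) (hS : S.Nonempty)
    (h : ∀ e, ∀ u ∈ G.ends e, ∀ v ∈ G.ends e, u ∈ S → v ∈ S) : S = Set.univ := by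
  obtain ⟨u, hu⟩ := hS
  refine Set.eq_univ_of_forall fun w => ?_
  obtain ⟨s, v, e, ⟨⟨h0, hwalk⟩, -, -⟩, hvu, hvw⟩ := hG u u.2 w w.2
  have key : ∀ i, ∃ hi : v i ∈ G.vertexSet, (⟨v i, hi⟩ : G.vertexSet) ∈ S := by
    intro i
    induction i using Fin.induction with
    | zero => exact ⟨h0, by simpa only [hvu] using hu⟩
    | succ i ih =>
      obtain ⟨hi, hiS⟩ := ih
      obtain ⟨he, h1, h2, -⟩ := hwalk i
      exact ⟨G.mem_vertexSet_of_mem_edgeSet he h2,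
        h ⟨e i, he⟩ _ (G.mem_ends.mpr h1) _ (G.mem_ends.mpr h2) hiS⟩
  obtain ⟨_, hw⟩ := key (Fin.last s)
  simpa only [hvw] using hw

variable {G}

open Classical in
/-- A labelling of the incidences, with product at least one on every edge, bounds the
`α`-spectral radius; when the bound is attained the products are one. -/
theorem alphaSpectralRadius_le {k : ℕ} (hk : 1 ≤ k) (hG : G.IsUniform k) {α : ℝ} (hα0 : 0 ≤ α)
    (hα1 : α < 1) {b : G.vertexSet → G.edgeSet → ℝ} (hb : ∀ e, ∀ v ∈ G.ends e, 0 < b v e)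
    (hprod : ∀ e, 1 ≤ ∏ v ∈ G.ends e, b v e) {r : ℝ} (hr : 0 < r)
    (hsum : ∀ v, α * (Finset.univ.filter fun e => v ∈ G.ends e).card +
      (1 - α) * ∑ e with v ∈ G.ends e, b v e ≤ r) :
    G.alphaSpectralRadius k α ≤ r ∧ (G.IsConnected → G.alphaSpectralRadius k α = r →
      ∀ e, ∏ v ∈ G.ends e, b v e = 1) := by
  have hbound (c : ℂ) (hc : (G.alphaTensor k α).IsEigenvalue c) : ‖c‖ ≤ r := by
    obtain ⟨y, hy, h⟩ := (G.isEigenvalue_alphaTensor_iff hG α c).mp hc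
    exact (h.norm_le hk (G.card_ends hG) hα0 hα1 hb hprod hsum hy).1
  refine ⟨Real.sSup_le ?_ hr.le, fun hconn hρ => ?_⟩
  · rintro _ ⟨c, hc, rfl⟩
    exact hbound c hc
  -- Without eigenvalues the supremum of the empty set would be 0, contrary to r > 0.
  · have hne : ∃ c, (G.alphaTensor k α).IsEigenvalue c := by
      by_contra! hne
      have : G.alphaSpectralRadius k α = 0 := by
        rw [alphaSpectralRadius, HTensor.spectralRadius]
        simp [hne]
      linarith
    obtain ⟨c, hc, hcr⟩ := HTensor.exists_isEigenvalue_of_bounded _ hbound hne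
    obtain ⟨y, hy, h⟩ := (G.isEigenvalue_alphaTensor_iff hG α c).mp hc
    exact (h.norm_le hk (G.card_ends hG) hα0 hα1 hb hprod hsum hy).2 (hcr.trans hρ)
      fun S hS h => hconn.eq_univ S hS h

open Classical in
/-- An eigenvalue with a positive eigenvector is the `α`-spectral radius. -/
theorem alphaSpectralRadius_eq {k : ℕ} (hk : 1 ≤ k) (hG : G.IsUniform k) {α : ℝ} (hα0 : 0 ≤ α)
    (hα1 : α < 1) [Nonempty G.vertexSet] {x : G.vertexSet → ℝ} (hx : ∀ v, 0 < x v) {r : ℝ}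
    (hr : 0 < r)
    (h : ∀ v, α * (Finset.univ.filter fun e => v ∈ G.ends e).card * x v ^ k +
      (1 - α) * ∑ e with v ∈ G.ends e, ∏ u ∈ G.ends e, x u = r * x v ^ k) :
    G.alphaSpectralRadius k α = r := by
  have hpow (v : G.vertexSet) : 0 < x v ^ k := pow_pos (hx v) k
  have hP (e : G.edgeSet) : 0 < ∏ u ∈ G.ends e, x u := Finset.prod_pos fun u _ => hx u
  -- A positive eigenvector yields labels ∏x / x_v^k with edge product exactly 1 and vertex sums
  -- exactly r, so the label bound gives ρ ≤ r.
  have hprod (e : G.edgeSet) : ∏ v ∈ G.ends e, (∏ u ∈ G.ends e, x u) / x v ^ k = 1 := by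
    rw [Finset.prod_div_distrib, Finset.prod_const, G.card_ends hG, Finset.prod_pow,
      div_self (pow_pos (hP e) k).ne']
  have hsum (v : G.vertexSet) : α * (Finset.univ.filter fun e => v ∈ G.ends e).card +
      (1 - α) * ∑ e with v ∈ G.ends e, (∏ u ∈ G.ends e, x u) / x v ^ k ≤ r := by
    refine le_of_mul_le_mul_right (le_of_eq ?_) (hpow v)
    rw [← h v, add_mul, ← Finset.sum_div, mul_assoc (1 - α), div_mul_cancel₀ _ (hpow v).ne']
  refine le_antisymm (alphaSpectralRadius_le hk hG hα0 hα1
    (fun e v _ => div_pos (hP e) (hpow v)) (fun e => (hprod e).ge) hr hsum).1 ?_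
  have hev : (G.alphaTensor k α).IsEigenvalue r := by
    refine (G.isEigenvalue_alphaTensor_iff hG α r).mpr ⟨fun v => x v, fun h0 => ?_, fun v => ?_⟩
    · obtain ⟨v⟩ := ‹Nonempty G.vertexSet›
      exact (hx v).ne' (by simpa using congrFun h0 v)
    · have h2 : α * (Finset.univ.filter fun e => v ∈ G.ends e).card * x v ^ (k - 1) +
          (1 - α) * ∑ e with v ∈ G.ends e, ∏ u ∈ (G.ends e).erase v, x u =
          r * x v ^ (k - 1) := by
        have h3 : ∑ e with v ∈ G.ends e, ∏ u ∈ G.ends e, x u =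
            x v * ∑ e with v ∈ G.ends e, ∏ u ∈ (G.ends e).erase v, x u := by
          rw [Finset.mul_sum]
          refine Finset.sum_congr rfl fun e he => ?_
          rw [Finset.mul_prod_erase _ _ (by simpa using he)]
        have h4 := h v
        rw [h3, show x v ^ k = x v * x v ^ (k - 1) by
          rw [← pow_succ', Nat.sub_add_cancel hk]] at h4
        refine mul_left_cancel₀ (hx v).ne' ?_
        linarith
      have h6 := congrArg Complex.ofReal h2
      push_cast at h6
      exact h6
  refine le_csSup ⟨r, ?_⟩ ⟨r, hev, by rw [Complex.norm_of_nonneg hr.le]⟩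
  rintro _ ⟨c, hc, rfl⟩
  obtain ⟨y, hy, h5⟩ := (G.isEigenvalue_alphaTensor_iff hG α c).mp hc
  exact (h5.norm_le hk (G.card_ends hG) hα0 hα1 (fun e v _ => div_pos (hP e) (hpow v))
    (fun e => (hprod e).ge) hsum hy).1

end SpectralRadius

end Hypergraph


/-! ### Rooted incidence trees and sums over branches -/

namespace Hypergraph

/-- A tree structure, rooted at the edge `e₀`, on the bipartite incidence relation `J`: every vertex
`v` has a parent edge `up v`, and every edge other than `e₀` has a parent vertex `top e`. -/
structure EdgeRooted {V E : Type*} (J : V → E → Prop) (e₀ : E) where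
  /-- The parent edge of a vertex. -/
  up : V → E
  /-- The parent vertex of an edge other than the root. -/
  top : E → V
  /-- The distance to the root. -/
  depth : E → ℕ
  adj_iff : ∀ v e, J v e ↔ up v = e ∨ (e ≠ e₀ ∧ top e = v)
  depth_lt : ∀ e, e ≠ e₀ → depth (up (top e)) < depth e

namespace EdgeRooted

variable {V E : Type*} {J : V → E → Prop} {e₀ : E} (R : EdgeRooted J e₀)

include R

lemma up_top_ne {e : E} (he : e ≠ e₀) : R.up (R.top e) ≠ e := fun h => by
  have := R.depth_lt e he
  rw [h] at this
  exact this.false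

/-- Justifies recursion from the leaves to the root: depths are bounded on a finite set of edges, so
the bound minus the depth decreases from an edge to its children. -/
lemma wellFounded_child [Finite E] :
    WellFounded fun f e : E => f ≠ e₀ ∧ R.up (R.top f) = e := by
  obtain ⟨D, hD⟩ := (Set.finite_range R.depth).bddAbove
  refine Subrelation.wf (r := InvImage (· < ·) fun e => D - R.depth e) ?_
    (InvImage.wf _ Nat.lt_wfRel.wf)
  rintro f e ⟨hf, h⟩
  have h1 := R.depth_lt f hf
  have h2 := hD ⟨f, rfl⟩
  rw [h] at h1
  show D - R.depth f < D - R.depth e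
  omega

variable [Fintype V] [Fintype E] [DecidableEq V] [DecidableEq E]

/-- Sums of weights over the branches of a rooted tree. -/
lemma exists_branch_sums (wE : E → ℕ) (wV : V → ℕ) : ∃ (s : E → ℕ) (S : V → ℕ),
    (∀ v, S v = wV v + ∑ f with f ≠ e₀ ∧ R.top f = v, s f) ∧
    (∀ e, s e = wE e + ∑ v with R.up v = e, S v) ∧ s e₀ = ∑ e, wE e + ∑ v, wV v := by
  classical
  set w : E → ℕ := fun e => wE e + ∑ v with R.up v = e, wV v with hw
  -- The vertices between an edge and its child edges are eliminated, so that the recursion runs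
  -- over edges only.
  obtain ⟨s, hs⟩ : ∃ s : E → ℕ, ∀ e, s e = w e + ∑ f with f ≠ e₀ ∧ R.up (R.top f) = e, s f := by
    refine ⟨R.wellFounded_child.fix fun e ih => w e + ∑ f, if h : f ≠ e₀ ∧ R.up (R.top f) = e
      then ih f h else 0, fun e => ?_⟩
    rw [WellFounded.fix_eq, Finset.sum_filter]
    congr 1
  have hsum : ∀ e, s e = wE e + ∑ v with R.up v = e,
      (wV v + ∑ f with f ≠ e₀ ∧ R.top f = v, s f) := by
    intro e
    rw [hs e, Finset.sum_add_distrib, ← add_assoc]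
    congr 1
    simp only [Finset.sum_filter]
    simp only [← Finset.sum_filter (p := fun v => R.up v = e)]
    rw [Finset.sum_comm]
    refine Finset.sum_congr rfl fun f _ => ?_
    by_cases hf : f ≠ e₀
    · simp [hf, Finset.sum_ite_eq]
    · simp [hf]
  refine ⟨s, fun v => wV v + ∑ f with f ≠ e₀ ∧ R.top f = v, s f, fun v => rfl, hsum, ?_⟩
  -- Summing the recursion over all edges, every s f with f ≠ e₀ appears on both sides; only s e₀
  -- and the total weight survive.
  have h1 : ∑ e, s e = ∑ e, wE e + ∑ v, (wV v + ∑ f with f ≠ e₀ ∧ R.top f = v, s f) := by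
    rw [Finset.sum_congr rfl fun e _ => hsum e, Finset.sum_add_distrib, Finset.sum_fiberwise]
  have h2 : ∑ v, ∑ f with f ≠ e₀ ∧ R.top f = v, s f = ∑ f with f ≠ e₀, s f := by
    rw [← Finset.sum_fiberwise _ R.top]
    simp only [Finset.filter_filter]
  have h3 : ∑ e, s e = s e₀ + ∑ f with f ≠ e₀, s f := by
    rw [← Finset.add_sum_erase _ _ (Finset.mem_univ e₀)]
    congr 1
    refine Finset.sum_congr ?_ fun _ _ => rfl
    ext; simp
  rw [Finset.sum_add_distrib, h2, h3] at h1
  omega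

lemma filter_edges (v : V) [DecidablePred (J v)] : Finset.univ.filter (J v) =
    insert (R.up v) (Finset.univ.filter fun f => f ≠ e₀ ∧ R.top f = v) := by
  ext e
  simp [R.adj_iff, eq_comm (a := e)]

lemma up_notMem (v : V) : R.up v ∉ Finset.univ.filter fun f => f ≠ e₀ ∧ R.top f = v := by
  simp only [Finset.mem_filter, Finset.mem_univ, true_and, not_and]
  intro h h'
  exact R.up_top_ne h (by rw [h'])

lemma filter_vertices {e : E} (he : e ≠ e₀) [DecidablePred (J · e)] :
    Finset.univ.filter (J · e) = insert (R.top e) (Finset.univ.filter fun v => R.up v = e) := by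
  ext v
  simp [R.adj_iff, he, eq_comm (a := v), or_comm]

lemma top_notMem {e : E} (he : e ≠ e₀) :
    R.top e ∉ Finset.univ.filter fun v => R.up v = e := by
  simp [R.up_top_ne he]

lemma filter_vertices_root [DecidablePred (J · e₀)] :
    Finset.univ.filter (J · e₀) = Finset.univ.filter fun v => R.up v = e₀ := by
  ext v
  simp [R.adj_iff]

/-- Numbers of edges in the branches of a rooted tree. -/
lemma exists_sizes : ∃ (s : E → ℕ) (S : V → ℕ),
    (∀ v, S v = ∑ f with f ≠ e₀ ∧ R.top f = v, s f) ∧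
    (∀ e, s e = 1 + ∑ v with R.up v = e, S v) ∧ s e₀ = Fintype.card E := by
  obtain ⟨s, S, h1, h2, h3⟩ := R.exists_branch_sums (fun _ => 1) (fun _ => 0)
  exact ⟨s, S, by simpa using h1, h2, by simpa using h3⟩

variable {s : E → ℕ} {S : V → ℕ} (hS : ∀ v, S v = ∑ f with f ≠ e₀ ∧ R.top f = v, s f)
  (hs : ∀ e, s e = 1 + ∑ v with R.up v = e, S v)

include hs in
lemma size_vertex_lt (v : V) : S v + 1 ≤ s (R.up v) := by
  rw [hs (R.up v), add_comm]
  gcongr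
  exact Finset.single_le_sum (f := S) (fun _ _ => Nat.zero_le _) (by simp)

include hS in
lemma size_edge_le {e : E} (he : e ≠ e₀) : s e ≤ S (R.top e) := by
  rw [hS]
  exact Finset.single_le_sum (f := s) (fun _ _ => Nat.zero_le _) (by simp [he])

include hS hs in
lemma size_le_root (e : E) : s e ≤ s e₀ := by
  induction hd : R.depth e using Nat.strong_induction_on generalizing e with
  | _ n ih =>
    by_cases he : e = e₀
    · rw [he]
    · have h1 := ih _ (hd ▸ R.depth_lt e he) _ rfl
      have h2 := R.size_vertex_lt hs (R.top e)
      have h3 := R.size_edge_le hS he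
      omega

include hS hs in
lemma size_lt_root {e : E} (he : e ≠ e₀) : s e + 1 ≤ s e₀ := by
  have h1 := R.size_le_root hS hs (R.up (R.top e))
  have h2 := R.size_vertex_lt hs (R.top e)
  have h3 := R.size_edge_le hS he
  omega

end EdgeRooted

/-! ### Weierstrass product inequalities -/

section Products

variable {V : Type*}

/-- This is 1 - ∑ y_v ≤ ∏ (1 - y_v) for y = x/q, multiplied by q^(|A|+1) so that neither division
nor the exponent |A| - 1 appears. The induction discards the nonnegative cross term of x a with the
remaining sum. -/
lemma pow_mul_sub_sum_le (A : Finset V) {q : ℝ} (hq : 0 < q) (x : V → ℝ) (hx : ∀ v ∈ A, 0 ≤ x v)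
    (hsum : ∑ v ∈ A, x v ≤ q) :
    q ^ A.card * (q - ∑ v ∈ A, x v) ≤ q * ∏ v ∈ A, (q - x v) := by
  classical
  induction A using Finset.induction_on with
  | empty => simp
  | insert a A ha ih =>
    rw [Finset.sum_insert ha] at hsum ⊢
    rw [Finset.prod_insert ha, Finset.card_insert_of_notMem ha]
    have h0 : 0 ≤ ∑ v ∈ A, x v :=
      Finset.sum_nonneg fun v hv => hx v (Finset.mem_insert_of_mem hv)
    have ha0 := hx a (Finset.mem_insert_self _ _)
    have h1 := ih (fun v hv => hx v (Finset.mem_insert_of_mem hv)) (by linarith)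
    have h2 := mul_le_mul_of_nonneg_left h1 (by linarith : 0 ≤ q - x a)
    have h3 : 0 ≤ q ^ A.card * (x a * ∑ v ∈ A, x v) := by positivity
    calc _ = (q - x a) * (q ^ A.card * (q - ∑ v ∈ A, x v)) -
          q ^ A.card * (x a * ∑ v ∈ A, x v) := by ring
      _ ≤ (q - x a) * (q * ∏ v ∈ A, (q - x v)) := by linarith
      _ = _ := by ring

/-- Two positive entries make the discarded cross term positive. -/
lemma pow_mul_sub_sum_lt {A : Finset V} {q : ℝ} (hq : 0 < q) {x : V → ℝ}
    (hx : ∀ v ∈ A, 0 ≤ x v) (hsum : ∑ v ∈ A, x v ≤ q) {a b : V} (ha : a ∈ A) (hb : b ∈ A)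
    (hab : a ≠ b) (hxa : 0 < x a) (hxb : 0 < x b) :
    q ^ A.card * (q - ∑ v ∈ A, x v) < q * ∏ v ∈ A, (q - x v) := by
  classical
  have hx' : ∀ v ∈ A.erase a, 0 ≤ x v := fun v hv => hx v (Finset.mem_of_mem_erase hv)
  have h0 : 0 < ∑ v ∈ A.erase a, x v :=
    Finset.sum_pos' hx' ⟨b, Finset.mem_erase.mpr ⟨hab.symm, hb⟩, hxb⟩
  rw [← Finset.add_sum_erase _ _ ha] at hsum ⊢
  rw [← Finset.mul_prod_erase _ _ ha, ← Finset.card_erase_add_one ha]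
  have h1 := pow_mul_sub_sum_le (A.erase a) hq x hx' (by linarith)
  have h2 := mul_le_mul_of_nonneg_left h1 (by linarith : 0 ≤ q - x a)
  have h3 : 0 < q ^ (A.erase a).card * (x a * ∑ v ∈ A.erase a, x v) := by positivity
  calc _ = (q - x a) * (q ^ (A.erase a).card * (q - ∑ v ∈ A.erase a, x v)) -
        q ^ (A.erase a).card * (x a * ∑ v ∈ A.erase a, x v) := by ring
    _ < (q - x a) * (q * ∏ v ∈ A.erase a, (q - x v)) := by linarith
    _ = _ := by ring

/-- After the Weierstrass inequality only (p+t)(q-t) = pq + t(q-p-t) matters, which exceeds pq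
strictly between t = 0 and t = q-p. -/
lemma one_le_mul_prod_sub (A : Finset V) {p q t : ℝ} (hp : 0 < p) (hq : 0 < q)
    (hpq : p * q ^ A.card = 1) (x : V → ℝ) (hx : ∀ v ∈ A, 0 ≤ x v) (hsum : ∑ v ∈ A, x v = t)
    (ht : t ≤ q - p) : 1 ≤ (p + t) * ∏ v ∈ A, (q - x v) ∧
      (0 < t → t < q - p → 1 < (p + t) * ∏ v ∈ A, (q - x v)) := by
  have ht0 : 0 ≤ t := hsum ▸ Finset.sum_nonneg hx
  have h1 := pow_mul_sub_sum_le A hq x hx (by linarith)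
  rw [hsum] at h1
  have h2 := mul_le_mul_of_nonneg_left h1 (by linarith : 0 ≤ p + t)
  have hQ : 0 < q ^ A.card := pow_pos hq _
  have h3 : (p + t) * (q ^ A.card * (q - t)) = q + q ^ A.card * (t * (q - p - t)) := by
    linear_combination q * hpq
  rw [h3] at h2
  constructor
  · have : 0 ≤ q ^ A.card * (t * (q - p - t)) :=
      mul_nonneg hQ.le (mul_nonneg ht0 (by linarith))
    refine le_of_mul_le_mul_left (?_ : q * 1 ≤ q * _) hq
    linarith
  · intro h4 h5
    have : 0 < q ^ A.card * (t * (q - p - t)) := mul_pos hQ (mul_pos h4 (by linarith))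
    refine lt_of_mul_lt_mul_left (?_ : q * 1 < q * _) hq.le
    linarith

end Products

/-! ### Labels on hypertrees -/

section TreeLabels

variable {V E : Type*} [Fintype V] [Fintype E] [DecidableEq V] [DecidableEq E]

/-- The labelling of a hypertree that compares it with the hyperstar. -/
theorem exists_labels_of_tree {I : E → Finset V} {k : ℕ} (hk : 2 ≤ k)
    (hcard : ∀ e, (I e).card = k) {e₀ : E} (R : EdgeRooted (fun v e => v ∈ I e) e₀)
    {p q β : ℝ} (hp : 0 < p) (hβ : 0 ≤ β) (hq : q + β = Fintype.card E * (p + β))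
    (hpq : p * q ^ (k - 1) = 1) :
    ∃ b : V → E → ℝ, (∀ e, ∀ v ∈ I e, 0 < b v e) ∧ (∀ e, 1 ≤ ∏ v ∈ I e, b v e) ∧
      (∀ v, ∑ e with v ∈ I e, (b v e + β) = q + β) ∧
      ((∀ e, ∏ v ∈ I e, b v e = 1) →
        ∃ w, (∀ e, w ∈ I e) ∧ ∀ v, v ≠ w → ∃! e, v ∈ I e) := by
  obtain ⟨s, S, hS, hs, hroot⟩ := R.exists_sizes
  have hmem (v : V) (e : E) : v ∈ I e ↔ R.up v = e ∨ (e ≠ e₀ ∧ R.top e = v) := R.adj_iff v e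
  have hIe {e : E} (he : e ≠ e₀) : I e = insert (R.top e) (Finset.univ.filter fun v => R.up v = e) := by
    rw [← R.filter_vertices he]; simp
  have hI0 : I e₀ = Finset.univ.filter fun v => R.up v = e₀ := by
    rw [← R.filter_vertices_root]; simp
  set g : ℝ := p + β with hg
  have hg0 : 0 < g := by linarith
  have hqp : q - p = g * (Fintype.card E - 1) := by rw [hg] at *; linear_combination hq
  have hm (e : E) : (1 : ℝ) ≤ s e := by
    exact_mod_cast (by rw [hs]; exact Nat.le_add_right _ _ : 1 ≤ s e)
  have hmax (e : E) : (s e : ℝ) ≤ Fintype.card E := by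
    rw [← hroot]; exact_mod_cast R.size_le_root hS hs e
  have hlt {e : E} (he : e ≠ e₀) : (s e : ℝ) + 1 ≤ Fintype.card E := by
    rw [← hroot]; exact_mod_cast R.size_lt_root hS hs he
  have hSlt (v : V) : (S v : ℝ) + 1 ≤ s (R.up v) := by exact_mod_cast R.size_vertex_lt hs v
  have hq0 : 0 < q := by nlinarith [hm e₀, hmax e₀]
  have hSum (e : E) : ∑ v with R.up v = e, g * (S v : ℝ) = g * (s e - 1) := by
    rw [← Finset.mul_sum, hs e]; push_cast; ring
  -- With β added, a child edge f of v receives g for each edge of its branch, g * s f in all. These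
  -- amounts total g * S v, and the parent edge receives what is left of q + β.
  set b : V → E → ℝ := fun v e => if R.up v = e then q - g * S v else g * s e - β with hb
  have hbup {v : V} {e : E} (h : R.up v = e) : b v e = q - g * S v := if_pos h
  have hbtop {v : V} {e : E} (h : R.up v ≠ e) : b v e = g * s e - β := if_neg h
  have hbpos (v : V) (e : E) : 0 < b v e := by
    simp only [hb]
    split_ifs with h
    · nlinarith [hSlt v, hmax (R.up v)]
    · nlinarith [hm e]
  have hx0 (v : V) : 0 ≤ g * (S v : ℝ) := by positivity
  have hprod {e : E} (he : e ≠ e₀) : ∏ v ∈ I e, b v e =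
      (p + g * (s e - 1)) * ∏ v with R.up v = e, (q - g * S v) := by
    rw [hIe he, Finset.prod_insert (R.top_notMem he), hbtop (R.up_top_ne he)]
    congr 1
    · rw [hg]; ring
    · exact Finset.prod_congr rfl fun v hv => hbup (Finset.mem_filter.mp hv).2
  have hprod0 : ∏ v ∈ I e₀, b v e₀ = ∏ v ∈ I e₀, (q - g * S v) :=
    Finset.prod_congr rfl fun v hv => hbup (by simpa [hI0] using hv)
  have hcardup {e : E} (he : e ≠ e₀) : (Finset.univ.filter fun v => R.up v = e).card = k - 1 := by
    rw [← hcard e, hIe he, Finset.card_insert_of_notMem (R.top_notMem he), Nat.add_sub_cancel]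
  have hkey {e : E} (he : e ≠ e₀) := one_le_mul_prod_sub (Finset.univ.filter fun v => R.up v = e)
    hp hq0 (by rw [hcardup he]; exact hpq) _ (fun v _ => hx0 v) (hSum e)
    (by rw [hqp]; exact mul_le_mul_of_nonneg_left (by linarith [hmax e]) hg0.le)
  -- All other edges lie below the root, so here t takes its extreme value q - p, and the
  -- Weierstrass bound alone gives product at least 1.
  have hSum0 : ∑ v ∈ I e₀, g * (S v : ℝ) = q - p := by rw [hI0, hSum, hroot, hqp]
  have hqk : q ^ (I e₀).card * (q - (q - p)) = q := by
    rw [hcard, show k = (k - 1) + 1 by omega, pow_succ]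
    linear_combination q * hpq
  refine ⟨b, fun e v _ => hbpos v e, fun e => ?_, fun v => ?_, fun htight => ?_⟩
  · by_cases he : e = e₀
    · rw [he]
      have h1 := pow_mul_sub_sum_le (I e₀) hq0 _ (fun v _ => hx0 v) (by rw [hSum0]; linarith)
      rw [hSum0, hqk] at h1
      rw [hprod0]
      exact le_of_mul_le_mul_left (by linarith : q * 1 ≤ q * _) hq0
    · rw [hprod he]; exact (hkey he).1
  · have h1 : Finset.univ.filter (fun e => v ∈ I e) = _ := R.filter_edges v
    rw [h1, Finset.sum_insert (R.up_notMem v), hbup rfl, hS v]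
    rw [Finset.sum_congr rfl (g := fun f => g * (s f : ℝ))]
    · rw [← Finset.mul_sum]; push_cast; ring
    · intro f hf
      obtain ⟨h2, h3⟩ := (Finset.mem_filter.mp hf).2
      rw [hbtop (h3 ▸ R.up_top_ne h2)]; ring
  -- For e ≠ e₀ the value t = g(s e - 1) lies strictly below q - p, so tightness leaves only t = 0.
  · have hs1 {e : E} (he : e ≠ e₀) : s e = 1 := by
      by_contra hne
      have h2 : (1 : ℝ) < s e := lt_of_le_of_ne (hm e) (by exact_mod_cast Ne.symm hne)
      have h3 := (hkey he).2 (mul_pos hg0 (by linarith))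
        (by rw [hqp]; exact mul_lt_mul_of_pos_left (by linarith [hlt he]) hg0)
      rw [← hprod he, htight e] at h3
      exact h3.false
    have hone {u v : V} (hu : u ∈ I e₀) (hv : v ∈ I e₀) (hu0 : 0 < S u) (hv0 : 0 < S v) :
        u = v := by
      by_contra hne
      have h1 := pow_mul_sub_sum_lt hq0 (A := I e₀) (x := fun v => g * (S v : ℝ))
        (fun v _ => hx0 v) (by rw [hSum0]; linarith) hu hv hne (by positivity) (by positivity)
      rw [hSum0, hqk, ← hprod0, htight e₀] at h1
      linarith
    have htop {e : E} (he : e ≠ e₀) : R.top e ∈ I e₀ ∧ 0 < S (R.top e) := by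
      have h1 := R.size_edge_le hS he
      rw [hs1 he] at h1
      refine ⟨(hmem _ _).mpr (Or.inl ?_), h1⟩
      by_contra hne
      have h2 := R.size_vertex_lt hs (R.top e)
      rw [hs1 hne] at h2
      omega
    obtain ⟨w, hw0, hw⟩ : ∃ w ∈ I e₀, ∀ v ∈ I e₀, 0 < S v → v = w := by
      by_cases h : ∃ w ∈ I e₀, 0 < S w
      · obtain ⟨w, hw, hw0⟩ := h
        exact ⟨w, hw, fun v hv hv0 => hone hv hw hv0 hw0⟩
      · obtain ⟨w, hw⟩ : (I e₀).Nonempty := Finset.card_pos.mp (by rw [hcard]; omega)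
        exact ⟨w, hw, fun v hv hv0 => absurd ⟨v, hv, hv0⟩ h⟩
    have htopw {e : E} (he : e ≠ e₀) : R.top e = w := hw _ (htop he).1 (htop he).2
    refine ⟨w, fun e => ?_, fun v hv => ⟨R.up v, (hmem _ _).mpr (Or.inl rfl), fun e he => ?_⟩⟩
    · by_cases he : e = e₀
      · rw [he]; exact hw0
      · exact (hmem _ _).mpr (Or.inr ⟨he, htopw he⟩)
    · rcases (hmem _ _).mp he with h | ⟨h1, h2⟩
      · exact h.symm
      · exact absurd (h2.symm.trans (htopw h1)) hv

end TreeLabels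

end Hypergraph


namespace Hypergraph

/-! ### Product inequalities for the edges of the cycle -/

section CycleProducts

variable {V : Type*} (A : Finset V) {p p' q β N g a t w : ℝ}

/-- The product of the labels on an edge at which the cycle is cut open. -/
lemma one_le_cut_edge_prod (hp' : 0 < p') (hβ : 0 ≤ β) (hq : q - β = 2 * p' + N)
    (hpq : p' * (q - β) * q ^ A.card = 2) (x : V → ℝ) (hx : ∀ v ∈ A, 0 ≤ x v)
    (hsum : ∑ v ∈ A, x v = t) (ha : 0 ≤ a) (hat : a + t ≤ N) :
    1 ≤ (p' + a / 2 + t) * ((q - β - a) / 2 * ∏ v ∈ A, (q - x v)) ∧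
      ((p' + a / 2 + t) * ((q - β - a) / 2 * ∏ v ∈ A, (q - x v)) = 1 →
        t = 0 ∧ (a = 0 ∨ a = N)) := by
  have ht0 : 0 ≤ t := hsum ▸ Finset.sum_nonneg hx
  have hq0 : 0 < q := by linarith
  have h1 := pow_mul_sub_sum_le A hq0 x hx (by linarith)
  rw [hsum] at h1
  have h2 := mul_le_mul_of_nonneg_left h1
    (mul_nonneg (by linarith : 0 ≤ p' + a / 2 + t) (by linarith : 0 ≤ (q - β - a) / 2))
  have hQ : 0 < q ^ A.card := pow_pos hq0 _
  -- At t = 0 the relation q - β = 2p' + N gives (p' + a/2)(q - β - a) = p'(q - β) + a(N - a)/2.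
  -- Hence a = 0 and a = N are both tight: they correspond to the two possible centres.
  have h3 : (p' + a / 2 + t) * ((q - β - a) / 2) * (q ^ A.card * (q - t)) =
      q + q ^ A.card / 2 * (t * ((q - β - a) * (q - t) - p' * (q - β)) +
        a * (N - a) / 2 * (q - t)) := by
    have : N = q - β - 2 * p' := by linarith
    rw [this]
    linear_combination q / 2 * hpq
  rw [h3] at h2
  -- With Q = q - β, (Q-a)(Q-t) = Q(Q-a-t) + at, which is at least 2p'Q because a + t ≤ N.
  have h4 : 0 < (q - β - a) * (q - t) - p' * (q - β) := by
    have h5 : (q - β - a) * (q - β - t) ≤ (q - β - a) * (q - t) :=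
      mul_le_mul_of_nonneg_left (by linarith) (by linarith)
    have h6 : 0 ≤ a * t := mul_nonneg ha ht0
    have h7 : (q - β) * (2 * p') ≤ (q - β) * (q - β - a - t) :=
      mul_le_mul_of_nonneg_left (by linarith) (by linarith)
    have h8 : 0 < (q - β) * p' := mul_pos (by linarith) hp'
    nlinarith
  have h5 : 0 ≤ t * ((q - β - a) * (q - t) - p' * (q - β)) := mul_nonneg ht0 h4.le
  have h6 : 0 ≤ a * (N - a) / 2 * (q - t) :=
    mul_nonneg (by have := mul_nonneg ha (by linarith : 0 ≤ N - a); linarith) (by linarith)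
  have h7 : 0 ≤ q ^ A.card / 2 * (t * ((q - β - a) * (q - t) - p' * (q - β)) +
        a * (N - a) / 2 * (q - t)) := mul_nonneg (by linarith) (by linarith)
  constructor
  · exact le_of_mul_le_mul_left (by linarith : q * 1 ≤ q * _) hq0
  · intro h8
    have h9 : q ^ A.card / 2 * (t * ((q - β - a) * (q - t) - p' * (q - β)) +
        a * (N - a) / 2 * (q - t)) = 0 := by
      refine le_antisymm ?_ h7
      have : (p' + a / 2 + t) * ((q - β - a) / 2) * (q * ∏ v ∈ A, (q - x v)) = q := by
        linear_combination q * h8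
      linarith
    have h10 := (mul_eq_zero.mp h9).resolve_left (by linarith)
    have h11 : t = 0 :=
      (mul_eq_zero.mp (by linarith : t * ((q - β - a) * (q - t) - p' * (q - β)) = 0)).resolve_right
        h4.ne'
    have h12 := (mul_eq_zero.mp
      (by linarith : a * (N - a) / 2 * (q - t) = 0)).resolve_right (by linarith)
    have h13 : a * (N - a) = 0 := by linarith
    exact ⟨h11, (mul_eq_zero.mp h13).imp id fun h => by linarith⟩

/-- The product of the labels on an edge in the interior of the path into which the cycle is
opened. -/
lemma one_lt_path_edge_prod (hp' : 0 < p') (hβ : 0 ≤ β) (hq : q - β = 2 * p' + N)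
    (hpq : p' * (q - β) * q ^ A.card = 2) (x : V → ℝ) (hx : ∀ v ∈ A, 0 ≤ x v)
    (hsum : ∑ v ∈ A, x v = t) (hw : 0 ≤ w) (hg : 0 < g) (hwt : w + t + g ≤ N) :
    1 < (p' + w + t + g) * ((q - β - p' - w) * ∏ v ∈ A, (q - x v)) := by
  have ht0 : 0 ≤ t := hsum ▸ Finset.sum_nonneg hx
  have hq0 : 0 < q := by linarith
  have h1 := pow_mul_sub_sum_le A hq0 x hx (by linarith)
  rw [hsum] at h1
  have h2 := mul_le_mul_of_nonneg_left h1
    (mul_nonneg (by linarith : 0 ≤ p' + w + t + g) (by linarith : 0 ≤ q - β - p' - w))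
  have hQ : 0 < q ^ A.card := pow_pos hq0 _
  have hY : p' < q - β - p' - w := by linarith
  have h3 : p' * (q - β) / 2 ≤ (p' + w) * (q - β - p' - w) := by
    have : 0 ≤ w * (N - w) := mul_nonneg hw (by linarith)
    have : 0 ≤ p' * N := mul_nonneg hp'.le (by linarith)
    nlinarith
  have h4 : p' * (q - β) ≤ (q - β - p' - w) * (q - t) := by
    have h5 : (q - β - p' - w) * (2 * p' + w) ≤ (q - β - p' - w) * (q - t) :=
      mul_le_mul_of_nonneg_left (by linarith) (by linarith)
    have h6 : 0 ≤ w * (N - w) := mul_nonneg hw (by linarith)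
    have h7 : 0 ≤ p' * (N - w) := mul_nonneg hp'.le (by linarith)
    nlinarith
  have h5 : 0 < p' * (q - β) := mul_pos hp' (by linarith)
  -- Replacing q by q - t costs t p'(q-β)/2 in the part with p' + w, while the part with t + g
  -- contributes at least (t+g) p'(q-β). As g > 0, the inequality is strict.
  have h6 : p' * (q - β) / 2 * q < (p' + w + t + g) * (q - β - p' - w) * (q - t) := by
    have h7 := mul_le_mul_of_nonneg_right h3 (by linarith : 0 ≤ q - t)
    have h8 := mul_le_mul_of_nonneg_left h4 (by linarith : 0 ≤ t + g)
    have h9 : 0 ≤ t * (p' * (q - β)) := mul_nonneg ht0 h5.le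
    have h10 : 0 < g * (p' * (q - β)) := mul_pos hg h5
    nlinarith
  have h7 := mul_lt_mul_of_pos_left h6 hQ
  have h8 : q ^ A.card * (p' * (q - β) / 2 * q) = q := by linear_combination q / 2 * hpq
  refine lt_of_mul_lt_mul_left (?_ : q * 1 < q * _) hq0.le
  linarith

end CycleProducts

/-! ### The path from the root edge to a vertex -/

namespace EdgeRooted

variable {V E : Type*} {J : V → E → Prop} {e₀ : E} (R : EdgeRooted J e₀)
  [Fintype V] [Fintype E] [DecidableEq V] [DecidableEq E]

include R

/-- Indicators of the ancestors of a vertex. -/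
lemma exists_ancestor_indicator (v₁ : V) : ∃ (a : E → ℕ) (A : V → ℕ),
    (∀ v, A v = (if v = v₁ then 1 else 0) + ∑ f with f ≠ e₀ ∧ R.top f = v, a f) ∧
    (∀ e, a e = ∑ v with R.up v = e, A v) ∧ a e₀ = 1 := by
  -- With the weight concentrated at v₁, a branch sum tells whether v₁ lies in the branch.
  obtain ⟨s, S, h1, h2, h3⟩ := R.exists_branch_sums (fun _ => 0) (fun v => if v = v₁ then 1 else 0)
  exact ⟨s, S, h1, by simpa using h2, by simpa using h3⟩

variable {v₁ : V} {a : E → ℕ} {A : V → ℕ}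
  (hA : ∀ v, A v = (if v = v₁ then 1 else 0) + ∑ f with f ≠ e₀ ∧ R.top f = v, a f)
  (ha : ∀ e, a e = ∑ v with R.up v = e, A v) (ha0 : a e₀ = 1)

include ha in
lemma ancestor_vertex_le (v : V) : A v ≤ a (R.up v) := by
  rw [ha (R.up v)]
  exact Finset.single_le_sum (f := A) (fun _ _ => Nat.zero_le _) (by simp)

include hA in
lemma ancestor_edge_le {e : E} (he : e ≠ e₀) : a e ≤ A (R.top e) := by
  rw [hA]
  refine le_add_left ?_
  exact Finset.single_le_sum (f := a) (fun _ _ => Nat.zero_le _) (by simp [he])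

-- The values do not decrease towards the root, where the value is 1.
include hA ha ha0 in
lemma ancestor_le_one (e : E) : a e ≤ 1 := by
  induction hd : R.depth e using Nat.strong_induction_on generalizing e with
  | _ n ih =>
    by_cases he : e = e₀
    · rw [he, ha0]
    · exact (R.ancestor_edge_le hA he).trans ((R.ancestor_vertex_le ha _).trans
        (ih _ (hd ▸ R.depth_lt e he) _ rfl))

include hA ha ha0 in
lemma ancestor_self : A v₁ = 1 := by
  have h1 := (R.ancestor_vertex_le ha v₁).trans (R.ancestor_le_one hA ha ha0 _)
  have h2 := hA v₁
  rw [if_pos rfl] at h2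
  omega

include hA ha ha0 in
lemma ancestor_child_eq_zero {f : E} (hf : f ≠ e₀) (h : R.top f = v₁) : a f = 0 := by
  have h1 := hA v₁
  rw [R.ancestor_self hA ha ha0, if_pos rfl] at h1
  have h2 : ∑ f with f ≠ e₀ ∧ R.top f = v₁, a f = 0 := by omega
  exact (Finset.sum_eq_zero_iff.mp h2) f (by simp [hf, h])

-- Natural numbers with sum 1 have exactly one nonzero member: this child is the next vertex on the
-- path to v₁.
include ha in
lemma exists_ancestor_child {e : E} (he : a e = 1) :
    ∃ v, R.up v = e ∧ A v = 1 ∧ ∀ v', R.up v' = e → v' ≠ v → A v' = 0 := by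
  rw [ha e] at he
  obtain ⟨v, hv, hv0⟩ := Finset.exists_ne_zero_of_sum_ne_zero (he.trans_ne one_ne_zero)
  rw [← Finset.add_sum_erase _ _ hv] at he
  have h0 : ∑ x ∈ (Finset.univ.filter fun v => R.up v = e).erase v, A x = 0 := by omega
  refine ⟨v, by simpa using hv, by omega, fun v' h' hne => ?_⟩
  exact (Finset.sum_eq_zero_iff.mp h0) v' (by simp [h', hne])

variable {s : E → ℕ} {S : V → ℕ} (hS : ∀ v, S v = ∑ f with f ≠ e₀ ∧ R.top f = v, s f)
  (hs : ∀ e, s e = 1 + ∑ v with R.up v = e, S v)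

include hA ha hS hs

/-- The branch of an edge on the path contains the branches below v₁ and the edge itself; the
induction descends along the path. -/
lemma size_lt_of_ancestor_edge (e : E) (he : a e = 1) : S v₁ + 1 ≤ s e := by
  induction e using R.wellFounded_child.induction with
  | _ e ih =>
    obtain ⟨v, hv, hv1, -⟩ := R.exists_ancestor_child ha he
    have h1 := R.size_vertex_lt hs v
    rw [hv] at h1
    by_cases h : v = v₁
    · rwa [h] at h1
    · have h2 := hA v
      rw [hv1, if_neg h, zero_add] at h2
      obtain ⟨f, hf, hf0⟩ := Finset.exists_ne_zero_of_sum_ne_zero (h2.symm.trans_ne one_ne_zero)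
      have hf' := (Finset.mem_filter.mp hf).2
      have h3 := Finset.single_le_sum (f := a) (fun _ _ => Nat.zero_le _) hf
      have h4 := ih f ⟨hf'.1, by rw [hf'.2, hv]⟩ (by omega)
      have h5 := R.size_edge_le hS hf'.1
      rw [hf'.2] at h5
      omega

lemma size_lt_of_ancestor_vertex {v : V} (hv1 : A v = 1) (h : v ≠ v₁) : S v₁ + 1 ≤ S v := by
  have h2 := hA v
  rw [hv1, if_neg h, zero_add] at h2
  obtain ⟨f, hf, hf0⟩ := Finset.exists_ne_zero_of_sum_ne_zero (h2.symm.trans_ne one_ne_zero)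
  have hf' := (Finset.mem_filter.mp hf).2
  have h3 := Finset.single_le_sum (f := a) (fun _ _ => Nat.zero_le _) hf
  have h4 := R.size_lt_of_ancestor_edge hA ha hS hs f (by omega)
  have h5 := R.size_edge_le hS hf'.1
  rw [hf'.2] at h5
  omega

end EdgeRooted

end Hypergraph


namespace Hypergraph

/-! ### Labels on unicyclic hypergraphs -/

section CycleLabels

variable {V E : Type*} [Fintype V] [Fintype E] [DecidableEq V] [DecidableEq E]

/-- The removed incidence cannot be a parent relation. Hence the last edge `R.up v₁` of the path
differs from e₀, and the cycle has at least two edges. -/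
lemma up_ne_of_cut {I : E → Finset V} {e₀ : E} {v₁ : V}
    (R : EdgeRooted (fun v e => v ∈ I e ∧ ¬ (v = v₁ ∧ e = e₀)) e₀) : R.up v₁ ≠ e₀ :=
  fun h => ((R.adj_iff v₁ e₀).mpr (Or.inl h)).2 ⟨rfl, rfl⟩

lemma mem_iff_of_cut {I : E → Finset V} {e₀ : E} {v₁ : V} (hv₁ : v₁ ∈ I e₀)
    (R : EdgeRooted (fun v e => v ∈ I e ∧ ¬ (v = v₁ ∧ e = e₀)) e₀) (v : V) (e : E) :
    v ∈ I e ↔ R.up v = e ∨ (e ≠ e₀ ∧ R.top e = v) ∨ (v = v₁ ∧ e = e₀) := by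
  rw [← or_assoc, ← R.adj_iff]
  constructor
  · intro h
    by_cases h' : v = v₁ ∧ e = e₀
    · exact Or.inr h'
    · exact Or.inl ⟨h, h'⟩
  · rintro (h | ⟨rfl, rfl⟩)
    · exact h.1
    · exact hv₁

/-- The shape of a unicyclic hypergraph for which the labelling below is tight. -/
lemma exists_centers_of_tight {I : E → Finset V} {e₀ : E} {v₁ : V} (hv₁ : v₁ ∈ I e₀)
    (R : EdgeRooted (fun v e => v ∈ I e ∧ ¬ (v = v₁ ∧ e = e₀)) e₀)
    {s : E → ℕ} {S : V → ℕ} (hS : ∀ v, S v = ∑ f with f ≠ e₀ ∧ R.top f = v, s f)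
    (hs : ∀ e, s e = 1 + ∑ v with R.up v = e, S v) (hroot : s e₀ = Fintype.card E)
    {a : E → ℕ} {A : V → ℕ}
    (hA : ∀ v, A v = (if v = v₁ then 1 else 0) + ∑ f with f ≠ e₀ ∧ R.top f = v, a f)
    (ha : ∀ e, a e = ∑ v with R.up v = e, A v) (ha0 : a e₀ = 1)
    (hs1 : ∀ e, a e = 0 → s e = 1) (hapath : ∀ e, a e = 1 → e = e₀ ∨ e = R.up v₁)
    (hz1 : ∀ v, R.up v = R.up v₁ → v ≠ v₁ → S v = 0) {v₀ : V} (hv0 : R.up v₀ = e₀)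
    (hz0 : ∀ v, R.up v = e₀ → v ≠ v₀ → S v = 0)
    (hSv : S v₁ = 0 ∨ S v₁ + 2 = Fintype.card E) :
    ∃ w u, w ≠ u ∧ (∀ e, w ∈ I e) ∧ (∃ e f, e ≠ f ∧ ∀ g, u ∈ I g ↔ g = e ∨ g = f) ∧
      ∀ v, v ≠ w → v ≠ u → ∃! e, v ∈ I e := by
  have hmem := mem_iff_of_cut hv₁ R
  have hf1 := up_ne_of_cut R
  have hv01 : v₀ ≠ v₁ := fun h => hf1 (h ▸ hv0)
  have hm (e : E) : 1 ≤ s e := by rw [hs]; exact Nat.le_add_right _ _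
  have haone := R.ancestor_le_one hA ha ha0
  have haf1 : a (R.up v₁) = 1 :=
    le_antisymm (haone _) (R.ancestor_self hA ha ha0 ▸ R.ancestor_vertex_le ha v₁)
  -- Off the path every edge is childless, and the path edges are only e₀ and `R.up v₁`; so v₀ and
  -- v₁ alone can have edges below them.
  have hS0 {v : V} (hne0 : v ≠ v₀) (hne1 : v ≠ v₁) : S v = 0 := by
    rcases Nat.le_one_iff_eq_zero_or_eq_one.mp (haone (R.up v)) with h1 | h1
    · have h2 := R.size_vertex_lt hs v
      rw [hs1 _ h1] at h2; omega
    · rcases hapath _ h1 with h2 | h2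
      · exact hz0 v h2 hne0
      · exact hz1 v h2 hne1
  have htop {e : E} (he : e ≠ e₀) : R.top e = v₀ ∨ R.top e = v₁ := by
    by_contra h
    push Not at h
    have h1 := R.size_edge_le hS he
    have h2 := hm e
    rw [hS0 h.1 h.2] at h1
    omega
  have htopf1 : R.top (R.up v₁) = v₀ := by
    refine (htop hf1).resolve_right fun h => ?_
    have := R.ancestor_child_eq_zero hA ha ha0 hf1 h
    omega
  have hunique {v : V} (h0 : v ≠ v₀) (h1 : v ≠ v₁) : ∃! e, v ∈ I e := by
    refine ⟨R.up v, (hmem _ _).mpr (Or.inl rfl), fun e he => ?_⟩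
    rcases (hmem _ _).mp he with h | ⟨h2, h3⟩ | ⟨h2, -⟩
    · exact h.symm
    · rcases htop h2 with h4 | h4
      · exact absurd (h3.symm.trans h4) h0
      · exact absurd (h3.symm.trans h4) h1
    · exact absurd h2 h1
  have hm0 : v₀ ∈ I e₀ := (hmem _ _).mpr (Or.inl hv0)
  have hm0' : v₀ ∈ I (R.up v₁) := (hmem _ _).mpr (Or.inr (Or.inl ⟨hf1, htopf1⟩))
  have hm1' : v₁ ∈ I (R.up v₁) := (hmem _ _).mpr (Or.inl rfl)
  -- If no edge hangs at v₁, the centre is v₀. Otherwise all edges but the two on the cycle hang at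
  -- v₁, which is then the centre.
  by_cases hcase : S v₁ = 0
  · have htop0 {e : E} (he : e ≠ e₀) : R.top e = v₀ := by
      refine (htop he).resolve_right fun h => ?_
      have h1 := R.size_edge_le hS he
      have h2 := hm e
      rw [h, hcase] at h1
      omega
    refine ⟨v₀, v₁, hv01, fun e => ?_, ⟨e₀, R.up v₁, hf1.symm, fun e => ?_⟩,
      fun v h0 h1 => hunique h0 h1⟩
    · by_cases he : e = e₀
      · rw [he]; exact hm0
      · exact (hmem _ _).mpr (Or.inr (Or.inl ⟨he, htop0 he⟩))
    · refine ⟨fun he => ?_, by rintro (rfl | rfl) <;> assumption⟩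
      rcases (hmem _ _).mp he with h | ⟨h2, h3⟩ | ⟨-, h2⟩
      · exact Or.inr h.symm
      · exact absurd ((htop0 h2).symm.trans h3) hv01
      · exact Or.inl h2
  · have hSv1 := hSv.resolve_left hcase
    have htop1 {e : E} (he : e ≠ e₀) (hne : e ≠ R.up v₁) : R.top e = v₁ := by
      refine (htop he).resolve_left fun h => ?_
      -- A second child edge at v₀ would give S v₀ ≥ 1 + (S v₁ + 1) = |E|, but S v₀ is at most |E| -
      -- 1.
      have h1 : s e + s (R.up v₁) ≤ S v₀ := by
        rw [hS v₀, ← Finset.sum_pair hne]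
        refine Finset.sum_le_sum_of_subset fun f hf => ?_
        rcases Finset.mem_insert.mp hf with rfl | hf
        · simp [he, h]
        · rw [Finset.mem_singleton.mp hf]; simp [hf1, htopf1]
      have h3 := R.size_vertex_lt hs v₀
      have h4 := R.size_vertex_lt hs v₁
      have h5 := hm e
      rw [hv0, hroot] at h3
      omega
    refine ⟨v₁, v₀, hv01.symm, fun e => ?_, ⟨e₀, R.up v₁, hf1.symm, fun e => ?_⟩,
      fun v h1 h0 => hunique h0 h1⟩
    · by_cases he : e = e₀
      · rw [he]; exact hv₁
      · by_cases hne : e = R.up v₁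
        · rw [hne]; exact hm1'
        · exact (hmem _ _).mpr (Or.inr (Or.inl ⟨he, htop1 he hne⟩))
    · refine ⟨fun he => ?_, by rintro (rfl | rfl) <;> assumption⟩
      rcases (hmem _ _).mp he with h | ⟨h2, h3⟩ | ⟨h2, -⟩
      · exact Or.inl (h.symm.trans hv0)
      · by_contra h4
        push Not at h4
        exact hv01 (h3.symm.trans (htop1 h2 h4.2))
      · exact absurd h2 hv01

set_option maxHeartbeats 800000 in
/-- The labelling of a unicyclic hypergraph, given as a rooted tree with one additional incidence
`(v₁, e₀)`, that compares it with the extremal unicyclic hypergraph. -/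
theorem exists_labels_of_unicyclic {I : E → Finset V} {k : ℕ} (hk : 3 ≤ k)
    (hcard : ∀ e, (I e).card = k) {e₀ : E} {v₁ : V} (hv₁ : v₁ ∈ I e₀)
    (R : EdgeRooted (fun v e => v ∈ I e ∧ ¬ (v = v₁ ∧ e = e₀)) e₀)
    {p p' q β : ℝ} (hp : 0 < p) (hp' : 0 < p') (hβ : 0 ≤ β)
    (hq : q - β = 2 * p' + (p + β) * (Fintype.card E - 2))
    (hpq : p * q ^ (k - 1) = 1) (hpq' : p' * (q - β) * q ^ (k - 2) = 2) :
    ∃ b : V → E → ℝ, (∀ e, ∀ v ∈ I e, 0 < b v e) ∧ (∀ e, 1 ≤ ∏ v ∈ I e, b v e) ∧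
      (∀ v, ∑ e with v ∈ I e, (b v e + β) = q + β) ∧
      ((∀ e, ∏ v ∈ I e, b v e = 1) →
        ∃ w u, w ≠ u ∧ (∀ e, w ∈ I e) ∧ (∃ e f, e ≠ f ∧ ∀ g, u ∈ I g ↔ g = e ∨ g = f) ∧
          ∀ v, v ≠ w → v ≠ u → ∃! e, v ∈ I e) := by
  classical
  obtain ⟨s, S, hS, hs, hroot⟩ := R.exists_sizes
  obtain ⟨a, A, hA, ha, ha0⟩ := R.exists_ancestor_indicator v₁
  have hmem := mem_iff_of_cut hv₁ R
  have hf1 := up_ne_of_cut R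
  have hIe {e : E} (he : e ≠ e₀) :
      I e = insert (R.top e) (Finset.univ.filter fun v => R.up v = e) := by
    ext v
    simp [hmem, he, eq_comm (a := v), or_comm]
  have hI0 : I e₀ = insert v₁ (Finset.univ.filter fun v => R.up v = e₀) := by
    ext v
    simp [hmem, or_comm]
  have hE (v : V) (hv : v ≠ v₁) : (Finset.univ.filter fun e => v ∈ I e) =
      insert (R.up v) (Finset.univ.filter fun f => f ≠ e₀ ∧ R.top f = v) := by
    ext e
    simp [hmem, hv, eq_comm (a := e)]
  have hE1 : (Finset.univ.filter fun e => v₁ ∈ I e) =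
      insert e₀ (insert (R.up v₁) (Finset.univ.filter fun f => f ≠ e₀ ∧ R.top f = v₁)) := by
    ext e
    simp only [Finset.mem_filter, Finset.mem_univ, true_and, Finset.mem_insert, hmem,
      eq_comm (b := e)]
    tauto
  have hv1n : v₁ ∉ Finset.univ.filter fun v => R.up v = e₀ := by simpa using hf1
  have hcardup (e : E) : (Finset.univ.filter fun v => R.up v = e).card = k - 1 := by
    by_cases he : e = e₀
    · rw [← hcard e₀, hI0, Finset.card_insert_of_notMem hv1n, Nat.add_sub_cancel, he]
    · rw [← hcard e, hIe he, Finset.card_insert_of_notMem (R.top_notMem he), Nat.add_sub_cancel]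
  have hcardup2 {e : E} {v : V} (h : R.up v = e) :
      ((Finset.univ.filter fun v => R.up v = e).erase v).card = k - 2 := by
    rw [Finset.card_erase_of_mem (by simpa using h), hcardup]; omega
  set g : ℝ := p + β with hg
  set N : ℝ := g * (Fintype.card E - 2) with hN
  set c : ℝ := g * S v₁ with hc
  -- Chosen so that, on `R.up v₁` and on e₀ alike, the cycle vertex other than v₁ has label p' + c/2
  -- + t, with t counting (times g) the edges below the vertices off the cycle.
  set δ : ℝ := p' - p - c / 2 with hδ
  have hg0 : 0 < g := by linarith
  have hm (e : E) : (1 : ℝ) ≤ s e := by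
    exact_mod_cast (by rw [hs]; exact Nat.le_add_right _ _ : 1 ≤ s e)
  have hmax (e : E) : (s e : ℝ) ≤ Fintype.card E := by
    rw [← hroot]; exact_mod_cast R.size_le_root hS hs e
  have hlt {e : E} (he : e ≠ e₀) : (s e : ℝ) + 1 ≤ Fintype.card E := by
    rw [← hroot]; exact_mod_cast R.size_lt_root hS hs he
  have hSlt (v : V) : (S v : ℝ) + 1 ≤ s (R.up v) := by exact_mod_cast R.size_vertex_lt hs v
  have hN0 : 0 ≤ N := mul_nonneg hg0.le (by linarith [hlt hf1, hm (R.up v₁)])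
  have hQ0 : 0 < q - β := by linarith
  have hq0 : 0 < q := by linarith
  -- Comparing the product equations of a cycle edge and a pendant edge; it yields p < p'.
  have hpp' : p' * (q - β) = 2 * (p * q) := by
    have h1 : 0 < q ^ (k - 2) := pow_pos hq0 _
    have h2 : p * (q ^ (k - 2) * q) = 1 := by
      rw [← pow_succ, show k - 2 + 1 = k - 1 by omega, hpq]
    refine mul_right_cancel₀ h1.ne' ?_
    linear_combination hpq' - 2 * h2
  have hplt : p < p' := by
    have : (q - β) * p < (q - β) * p' := by linarith [mul_pos hp hq0, mul_nonneg hβ hp.le]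
    exact lt_of_mul_lt_mul_left this hQ0.le
  have hSum (e : E) : ∑ v with R.up v = e, g * (S v : ℝ) = g * (s e - 1) := by
    rw [← Finset.mul_sum, hs e]; push_cast; ring
  have hx0 (v : V) : 0 ≤ g * (S v : ℝ) := by positivity
  have hc0 : 0 ≤ c := hx0 v₁
  have haone := R.ancestor_le_one hA ha ha0
  have hAone (v : V) : A v ≤ 1 := (R.ancestor_vertex_le ha v).trans (haone _)
  have hAself := R.ancestor_self hA ha ha0
  have haf1 : a (R.up v₁) = 1 :=
    le_antisymm (haone _) (hAself ▸ R.ancestor_vertex_le ha v₁)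
  -- These are the tree labels apart from two changes. At v₁ the two cycle labels are equal, using
  -- up what the branches below v₁ leave. At every other path vertex δ is taken from the parent edge
  -- and added on the path's child edge, so that the vertex sum is unchanged.
  set b : V → E → ℝ := fun v e => if v = v₁ ∧ (e = e₀ ∨ e = R.up v₁) then (q - β - c) / 2 else
    if R.up v = e then q - g * S v - δ * A v else g * s e - β + δ * a e with hb
  have hb1 {v : V} {e : E} (h : v = v₁ ∧ (e = e₀ ∨ e = R.up v₁)) : b v e = (q - β - c) / 2 :=
    if_pos h
  have hbup {v : V} {e : E} (h : R.up v = e) (h1 : v ≠ v₁) : b v e = q - g * S v - δ * A v := by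
    simp only [hb]
    rw [if_neg fun h' => h1 h'.1, if_pos h]
  have hbup0 {v : V} {e : E} (h : R.up v = e) (h1 : A v = 0) : b v e = q - g * S v := by
    rw [hbup h, h1]
    · simp
    · rintro rfl; omega
  have hbtop {e : E} (he : e ≠ e₀) : b (R.top e) e = g * s e - β + δ * a e := by
    simp only [hb]
    rw [if_neg, if_neg (R.up_top_ne he)]
    rintro ⟨h1, h2 | h2⟩
    · exact he h2
    · exact R.up_top_ne he (by rw [h1, h2])
  have hrest {e : E} {v : V} (hv : R.up v = e)
      (h : ∀ v', R.up v' = e → v' ≠ v → A v' = 0) :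
      ∏ v' with R.up v' = e, b v' e =
        b v e * ∏ v' ∈ (Finset.univ.filter fun v => R.up v = e).erase v, (q - g * S v') := by
    rw [← Finset.mul_prod_erase _ _ (by simpa using hv : v ∈ Finset.univ.filter fun v => R.up v = e)]
    congr 1
    refine Finset.prod_congr rfl fun v' hv' => ?_
    obtain ⟨h1, h2⟩ := Finset.mem_erase.mp hv'
    have h3 := (Finset.mem_filter.mp h2).2
    exact hbup0 h3 (h v' h3 h1)
  have hrestsum {e : E} {v : V} (hv : R.up v = e) :
      ∑ v' ∈ (Finset.univ.filter fun v => R.up v = e).erase v, g * (S v' : ℝ) =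
        g * (s e - 1) - g * S v := by
    rw [← hSum e, ← Finset.add_sum_erase (Finset.univ.filter fun v => R.up v = e) _
      (by simpa using hv : v ∈ _)]
    ring
  have hord {e : E} (he : a e = 0) : 1 ≤ ∏ v ∈ I e, b v e ∧
      (∏ v ∈ I e, b v e = 1 → s e = 1) := by
    have hne : e ≠ e₀ := by rintro rfl; omega
    have h0 : ∀ v, R.up v = e → A v = 0 := fun v hv => by
      have := R.ancestor_vertex_le ha v
      rw [hv] at this; omega
    have h1 : ∏ v ∈ I e, b v e =
        (p + g * (s e - 1)) * ∏ v with R.up v = e, (q - g * S v) := by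
      rw [hIe hne, Finset.prod_insert (R.top_notMem hne), hbtop hne, he]
      congr 1
      · rw [hg]; push_cast; ring
      · refine Finset.prod_congr rfl fun v hv => ?_
        have := (Finset.mem_filter.mp hv).2
        exact hbup0 this (h0 v this)
    have hle : g * ((s e : ℝ) - 1) < q - p := by
      have : g * ((s e : ℝ) - 1) ≤ g * (Fintype.card E - 2) :=
        mul_le_mul_of_nonneg_left (by linarith [hlt hne]) hg0.le
      linarith
    have h2 := one_le_mul_prod_sub (Finset.univ.filter fun v => R.up v = e) hp hq0
      (by rw [hcardup]; exact hpq) _ (fun v _ => hx0 v) (hSum e) hle.le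
    rw [h1]
    refine ⟨h2.1, fun h3 => ?_⟩
    by_contra h4
    have h5 : (1 : ℝ) < s e := lt_of_le_of_ne (hm e) (by exact_mod_cast Ne.symm h4)
    exact (h2.2 (mul_pos hg0 (by linarith)) hle).ne' h3
  have hcutbound {e : E} : e ≠ e₀ → g * ((s e : ℝ) - 1) ≤ N := fun he =>
    mul_le_mul_of_nonneg_left (by linarith [hlt he]) hg0.le
  have hf1prod := one_le_cut_edge_prod
    ((Finset.univ.filter fun v => R.up v = R.up v₁).erase v₁) (N := N) hp' hβ hq
    (by rw [hcardup2 rfl]; exact hpq') _ (fun v _ => hx0 v) (hrestsum rfl) hc0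
    (by have := hcutbound hf1; linarith)
  have hf1eq : ∏ v ∈ I (R.up v₁), b v (R.up v₁) = (p' + c / 2 + (g * (s (R.up v₁) - 1) - g * S v₁)) *
      ((q - β - c) / 2 * ∏ v' ∈ (Finset.univ.filter fun v => R.up v = R.up v₁).erase v₁,
        (q - g * S v')) := by
    obtain ⟨v, hv, hv1, hv'⟩ := R.exists_ancestor_child ha haf1
    have hvv : v₁ = v := by
      by_contra h
      have := hv' v₁ rfl h
      omega
    subst hvv
    rw [hIe hf1, Finset.prod_insert (R.top_notMem hf1), hbtop hf1, hrest rfl hv',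
      hb1 ⟨rfl, Or.inr rfl⟩, haf1]
    congr 1
    rw [hδ, hc, hg]; push_cast; ring
  obtain ⟨v₀, hv0, hv0A, hv0'⟩ := R.exists_ancestor_child ha ha0
  have hv01 : v₀ ≠ v₁ := fun h => hf1 (h ▸ hv0)
  -- Below v₀ lie the branches of v₁ and at least one further edge; this is the condition a + t ≤ N
  -- for the edge e₀.
  have hSv0 : c + g ≤ g * S v₀ := by
    have h1 := R.size_lt_of_ancestor_vertex hA ha hS hs hv0A hv01
    have h2 : (S v₁ : ℝ) + 1 ≤ S v₀ := by exact_mod_cast h1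
    linarith [mul_le_mul_of_nonneg_left h2 hg0.le]
  have h0prod := one_le_cut_edge_prod
    ((Finset.univ.filter fun v => R.up v = e₀).erase v₀) (N := N) hp' hβ hq
    (by rw [hcardup2 hv0]; exact hpq') _ (fun v _ => hx0 v) (hrestsum hv0) hc0
    (by rw [hroot]; linarith)
  have h0eq : ∏ v ∈ I e₀, b v e₀ = (p' + c / 2 + (g * (s e₀ - 1) - g * S v₀)) *
      ((q - β - c) / 2 * ∏ v' ∈ (Finset.univ.filter fun v => R.up v = e₀).erase v₀,
        (q - g * S v')) := by
    rw [hI0, Finset.prod_insert hv1n, hrest hv0 hv0', hb1 ⟨rfl, Or.inl rfl⟩, hbup hv0 hv01, hv0A,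
      show q - g * S v₀ - δ * ((1 : ℕ) : ℝ) = p' + c / 2 + (g * (s e₀ - 1) - g * S v₀) by
        rw [hδ, hroot]; push_cast; linarith]
    ring
  have hpath {e : E} (he : a e = 1) (hne : e ≠ e₀) (hne1 : e ≠ R.up v₁) :
      1 < ∏ v ∈ I e, b v e := by
    obtain ⟨v, hv, hv1, hv'⟩ := R.exists_ancestor_child ha he
    have hvv : v ≠ v₁ := fun h => hne1 (by rw [← hv, h])
    have h1 : (S v₁ : ℝ) + 1 ≤ S v := by
      exact_mod_cast R.size_lt_of_ancestor_vertex hA ha hS hs hv1 hvv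
    have h1' : c + g ≤ g * S v := by linarith [mul_le_mul_of_nonneg_left h1 hg0.le]
    -- This w makes the label of v equal q - β - p' - w and that of the parent vertex p' + w + t +
    -- g. It is nonnegative because g * S v ≥ c + g and c ≥ 0 are supplemented by the size relations
    -- only through g * S v - g ≥ c, which is at least c/2.
    have h2 := one_lt_path_edge_prod
      ((Finset.univ.filter fun v => R.up v = e).erase v) (N := N) (g := g)
      (w := g * S v - g - c / 2) hp' hβ hq (by rw [hcardup2 hv]; exact hpq') _
      (fun v _ => hx0 v) (hrestsum hv) (by linarith) hg0
      (by have := hcutbound hne; linarith)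
    refine lt_of_lt_of_eq h2 ?_
    rw [hIe hne, Finset.prod_insert (R.top_notMem hne), hbtop hne, hrest hv hv', hbup hv hvv, he, hv1]
    congr 1
    · rw [hδ, hg]; push_cast; ring
    · congr 1
      rw [hδ, hg]; push_cast; ring
  have hprod (e : E) : 1 ≤ ∏ v ∈ I e, b v e := by
    by_cases he : a e = 0
    · exact (hord he).1
    · have he1 : a e = 1 := le_antisymm (haone e) (by omega)
      by_cases h0 : e = e₀
      · rw [h0, h0eq]; exact h0prod.1
      · by_cases h1 : e = R.up v₁
        · rw [h1, hf1eq]; exact hf1prod.1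
        · exact (hpath he1 h0 h1).le
  have hcN : c ≤ N := mul_le_mul_of_nonneg_left (by linarith [hSlt v₁, hlt hf1]) hg0.le
  have hbpos (e : E) (v : V) (hv : v ∈ I e) : 0 < b v e := by
    by_cases h1 : v = v₁ ∧ (e = e₀ ∨ e = R.up v₁)
    · rw [hb1 h1]; linarith
    · rcases (hmem v e).mp hv with h2 | ⟨h2, rfl⟩ | ⟨h2, h3⟩
      · have h3 : v ≠ v₁ := by
          rintro rfl
          exact h1 ⟨rfl, Or.inr h2.symm⟩
        rw [hbup h2 h3]
        have h4 : g * (S v : ℝ) ≤ g * (Fintype.card E - 1) :=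
          mul_le_mul_of_nonneg_left (by linarith [hSlt v, hmax (R.up v)]) hg0.le
        rcases Nat.le_one_iff_eq_zero_or_eq_one.mp (hAone v) with h5 | h5 <;>
          · rw [h5, hδ]; push_cast; linarith
      · rw [hbtop h2]
        rcases Nat.le_one_iff_eq_zero_or_eq_one.mp (haone e) with h5 | h5
        · rw [h5]; push_cast; linarith [mul_le_mul_of_nonneg_left (hm e) hg0.le]
        · have h6 : (S v₁ : ℝ) + 1 ≤ s e := by
            exact_mod_cast R.size_lt_of_ancestor_edge hA ha hS hs e h5
          have h7 : c + g ≤ g * s e := by linarith [mul_le_mul_of_nonneg_left h6 hg0.le]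
          rw [h5, hδ]; push_cast; linarith
      · exact absurd ⟨h2, Or.inl h3⟩ h1
  have htopsum (v : V) : ∑ f with f ≠ e₀ ∧ R.top f = v, (b v f + β) =
      g * S v + δ * ∑ f with f ≠ e₀ ∧ R.top f = v, (a f : ℝ) := by
    rw [hS v, Finset.mul_sum]
    push_cast
    rw [Finset.mul_sum, ← Finset.sum_add_distrib]
    refine Finset.sum_congr rfl fun f hf => ?_
    obtain ⟨h2, h3⟩ := (Finset.mem_filter.mp hf).2
    rw [← h3, hbtop h2]; ring
  have hbsum (v : V) : ∑ e with v ∈ I e, (b v e + β) = q + β := by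
    have hAv := hA v
    by_cases hv : v = v₁
    · rw [hv] at hAv ⊢
      rw [hAself, if_pos rfl] at hAv
      have h0 : ∑ f with f ≠ e₀ ∧ R.top f = v₁, (a f : ℝ) = 0 := by
        exact_mod_cast (by omega : ∑ f with f ≠ e₀ ∧ R.top f = v₁, a f = 0)
      rw [hE1, Finset.sum_insert, Finset.sum_insert (R.up_notMem v₁), htopsum, h0,
        hb1 ⟨rfl, Or.inl rfl⟩, hb1 ⟨rfl, Or.inr rfl⟩]
      · ring
      · simp [hf1.symm]
    · rw [if_neg hv, zero_add] at hAv
      rw [hE v hv, Finset.sum_insert (R.up_notMem v), htopsum, hbup rfl hv, hAv]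
      push_cast; ring
  refine ⟨b, hbpos, hprod, hbsum, fun htight => ?_⟩
  have hapath {e : E} (he : a e = 1) : e = e₀ ∨ e = R.up v₁ := by
    by_contra h
    push Not at h
    exact (hpath he h.1 h.2).ne' (htight e)
  have hs1 {e : E} (he : a e = 0) : s e = 1 := (hord he).2 (htight e)
  obtain ⟨hf1t, hf1c⟩ := hf1prod.2 (hf1eq.symm.trans (htight _))
  obtain ⟨h0t, -⟩ := h0prod.2 (h0eq.symm.trans (htight _))
  have hzero {e : E} {v v' : V} (hv : R.up v = e) (hv' : R.up v' = e) (hne : v' ≠ v)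
      (ht : g * ((s e : ℝ) - 1) - g * S v = 0) : S v' = 0 := by
    have h1 := Finset.single_le_sum (f := fun v => g * (S v : ℝ)) (fun v _ => hx0 v)
      (by simp [hv', hne] : v' ∈ (Finset.univ.filter fun v => R.up v = e).erase v)
    rw [hrestsum hv, ht] at h1
    have h2 : g * (S v' : ℝ) = 0 := le_antisymm h1 (hx0 v')
    exact_mod_cast (mul_eq_zero.mp h2).resolve_left hg0.ne'
  refine exists_centers_of_tight hv₁ R hS hs hroot hA ha ha0 (fun e => hs1) (fun e => hapath)
    (fun v h hne => hzero rfl h hne hf1t) hv0 (fun v h hne => hzero hv0 h hne h0t)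
    (hf1c.imp (fun h => ?_) fun h => ?_)
  · exact_mod_cast (mul_eq_zero.mp h).resolve_left hg0.ne'
  · have h1 : (S v₁ : ℝ) = Fintype.card E - 2 := mul_left_cancel₀ hg0.ne' h
    have h2 : (S v₁ : ℝ) + 2 = Fintype.card E := by linarith
    exact_mod_cast h2

end CycleLabels

end Hypergraph

namespace Hypergraph

/-! ### The bipartite incidence graph, rooting it, and its cycles -/

section IncidenceGraph

variable {V E : Type*}

/-- The bipartite graph of an incidence relation. -/
def incidenceGraph (J : V → E → Prop) : SimpleGraph (V ⊕ E) where
  Adj x y := (∃ v e, x = Sum.inl v ∧ y = Sum.inr e ∧ J v e) ∨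
    ∃ v e, x = Sum.inr e ∧ y = Sum.inl v ∧ J v e
  symm := ⟨fun _ _ h => by
    rcases h with ⟨v, e, h1, h2, h3⟩ | ⟨v, e, h1, h2, h3⟩
    · exact Or.inr ⟨v, e, h2, h1, h3⟩
    · exact Or.inl ⟨v, e, h2, h1, h3⟩⟩
  loopless := ⟨fun x h => by rcases h with ⟨v, e, rfl, h2, -⟩ | ⟨v, e, rfl, h2, -⟩ <;> cases h2⟩

variable {J : V → E → Prop}

@[simp]
lemma incidenceGraph_adj_inl_inr {v : V} {e : E} :
    (incidenceGraph J).Adj (Sum.inl v) (Sum.inr e) ↔ J v e := by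
  simp [incidenceGraph]

@[simp]
lemma incidenceGraph_adj_inr_inl {v : V} {e : E} :
    (incidenceGraph J).Adj (Sum.inr e) (Sum.inl v) ↔ J v e := by
  simp [incidenceGraph]

@[simp]
lemma incidenceGraph_adj_inl_inl {v w : V} :
    ¬ (incidenceGraph J).Adj (Sum.inl v) (Sum.inl w) := by
  simp [incidenceGraph]

@[simp]
lemma incidenceGraph_adj_inr_inr {e f : E} :
    ¬ (incidenceGraph J).Adj (Sum.inr e) (Sum.inr f) := by
  simp [incidenceGraph]

end IncidenceGraph

section Parents

variable {W : Type*} {T : SimpleGraph W}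

lemma exists_adj_dist_add_one (hT : T.Connected) {r x : W} (hx : x ≠ r) :
    ∃ y, T.Adj x y ∧ T.dist r y + 1 = T.dist r x := by
  obtain ⟨p, hp⟩ := hT.exists_walk_length_eq_dist x r
  cases p with
  | nil => exact absurd rfl hx
  | cons h p =>
    rename_i y
    refine ⟨y, h, ?_⟩
    have h1 := SimpleGraph.dist_le p
    have h2 := hT.dist_triangle (u := x) (v := y) (w := r)
    have h3 := SimpleGraph.dist_eq_one_iff_adj.mpr h
    rw [SimpleGraph.Walk.length_cons] at hp
    rw [SimpleGraph.dist_comm (u := r) (v := y), SimpleGraph.dist_comm (u := r) (v := x)]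
    omega

/-- A shortest path from r to a closer neighbour avoids x and extends to a path ending at x. Since
paths in a tree are unique, so is its penultimate vertex. -/
lemma eq_of_adj_dist_add_one (hT : T.IsTree) {r x y z : W} (hy : T.Adj x y)
    (hyd : T.dist r y + 1 = T.dist r x) (hz : T.Adj x z) (hzd : T.dist r z + 1 = T.dist r x) :
    y = z := by
  classical
  have key : ∀ y, T.Adj x y → T.dist r y + 1 = T.dist r x →
      ∃ p : T.Walk r x, p.IsPath ∧ p.penultimate = y := by
    intro y hy hyd
    obtain ⟨p, hp, hpl⟩ := hT.connected.exists_path_of_dist r y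
    refine ⟨p.concat hy.symm, hp.concat (fun hx => ?_) hy.symm, by simp⟩
    have h1 := SimpleGraph.dist_le (p.takeUntil x hx)
    have h2 := p.length_takeUntil_le_length hx
    omega
  obtain ⟨p, hp, hpy⟩ := key y hy hyd
  obtain ⟨p', hp', hpz⟩ := key z hz hzd
  rw [← hpy, ← hpz, (hT.existsUnique_path r x).unique hp hp']

variable {V E : Type*} {J : V → E → Prop}

/-- An incidence relation that is a tree can be rooted at any edge. -/
lemma exists_edgeRooted [Nonempty V] (hT : (incidenceGraph J).IsTree) (e₀ : E) :
    Nonempty (EdgeRooted J e₀) := by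
  set d : V ⊕ E → ℕ := fun x => (incidenceGraph J).dist (Sum.inr e₀) x with hd
  have hup (v : V) : ∃ e, J v e ∧ d (Sum.inr e) + 1 = d (Sum.inl v) := by
    obtain ⟨y, hy, hyd⟩ := exists_adj_dist_add_one hT.connected (r := Sum.inr e₀)
      (x := Sum.inl v) (by simp)
    cases y with
    | inl w => simp at hy
    | inr e => exact ⟨e, by simpa using hy, hyd⟩
  have htop (e : E) : ∃ v, e ≠ e₀ → J v e ∧ d (Sum.inl v) + 1 = d (Sum.inr e) := by
    by_cases he : e = e₀
    · exact ⟨Classical.arbitrary V, fun h => absurd he h⟩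
    · obtain ⟨y, hy, hyd⟩ := exists_adj_dist_add_one hT.connected (r := Sum.inr e₀)
        (x := Sum.inr e) (by simpa using he)
      cases y with
      | inl v => exact ⟨v, fun _ => ⟨by simpa using hy, hyd⟩⟩
      | inr w => simp at hy
  choose up hup1 hup2 using hup
  choose top htop using htop
  refine ⟨⟨up, top, fun e => d (Sum.inr e), fun v e => ⟨fun h => ?_, ?_⟩, fun e he => ?_⟩⟩
  · have hadj : (incidenceGraph J).Adj (Sum.inl v) (Sum.inr e) := by simpa using h
    -- Distances of adjacent nodes differ by exactly 1; whichever end is closer to the root is the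
    -- parent of the other.
    rcases hT.dist_eq_dist_add_one_of_adj (Sum.inr e₀) hadj with h1 | h1
    · left
      have := eq_of_adj_dist_add_one hT (r := Sum.inr e₀) (x := Sum.inl v)
        (by simpa using hup1 v) (hup2 v) hadj h1.symm
      simpa using this
    · right
      have he : e ≠ e₀ := by
        rintro rfl
        simp at h1
      refine ⟨he, ?_⟩
      have := eq_of_adj_dist_add_one hT (r := Sum.inr e₀) (x := Sum.inr e)
        (by simpa using (htop e he).1) (htop e he).2 hadj.symm h1.symm
      simpa using this
  · rintro (rfl | ⟨he, rfl⟩)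
    · exact hup1 v
    · exact (htop e he).1
  · have h1 := (htop e he).2
    have h2 := hup2 (top e)
    omega

end Parents

section Cycles

variable {V E : Type*} {J : V → E → Prop}

/-- A cycle of the incidence graph, as an alternating sequence of vertices and edges. -/
lemma exists_cycle_of_not_isAcyclic (h : ¬ (incidenceGraph J).IsAcyclic) :
    ∃ (s : ℕ) (v : Fin (s + 1) → V) (e : Fin s → E), 2 ≤ s ∧
      (∀ i, J (v i.castSucc) (e i) ∧ J (v i.succ) (e i) ∧ v i.castSucc ≠ v i.succ) ∧
      Function.Injective e ∧ Function.Injective (fun i : Fin s => v i.castSucc) ∧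
      v 0 = v (Fin.last s) := by
  classical
  -- The cycle is rotated to start at a vertex of the hypergraph; then even positions are vertices
  -- and odd positions are edges.
  obtain ⟨v₀, c, hc⟩ : ∃ v₀ : V, ∃ c : (incidenceGraph J).Walk (Sum.inl v₀) (Sum.inl v₀),
      c.IsCycle := by
    simp only [SimpleGraph.IsAcyclic, not_forall, not_not] at h
    obtain ⟨x, c, hc⟩ := h
    cases x with
    | inl v => exact ⟨v, c, hc⟩
    | inr e =>
      have hadj := c.adj_snd hc.not_nil
      have hmem := c.getVert_mem_support 1
      cases hsnd : c.getVert 1 with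
      | inl v =>
        rw [hsnd] at hmem
        exact ⟨v, c.rotate _ hmem, hc.rotate hmem⟩
      | inr f =>
        rw [SimpleGraph.Walk.snd, hsnd] at hadj
        simp at hadj
  have hpar : ∀ i ≤ c.length, (Even i → ∃ v, c.getVert i = Sum.inl v) ∧
      (¬ Even i → ∃ e, c.getVert i = Sum.inr e) := by
    intro i
    induction i with
    | zero => exact fun _ => ⟨fun _ => ⟨v₀, by simp⟩, fun h => absurd Even.zero h⟩
    | succ i ih =>
      intro hi
      have hadj := c.adj_getVert_succ (i := i) (by omega)
      obtain ⟨h1, h2⟩ := ih (by omega)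
      rw [Nat.even_add_one]
      constructor
      · intro hodd
        obtain ⟨e, he⟩ := h2 hodd
        cases hx : c.getVert (i + 1) with
        | inl v => exact ⟨v, rfl⟩
        | inr f => rw [he, hx] at hadj; simp at hadj
      · intro heven
        obtain ⟨v, hv⟩ := h1 (not_not.mp heven)
        cases hx : c.getVert (i + 1) with
        | inl v => rw [hv, hx] at hadj; simp at hadj
        | inr f => exact ⟨f, rfl⟩
  have heven : Even c.length := by
    by_contra h
    obtain ⟨e, he⟩ := (hpar _ le_rfl).2 h
    rw [c.getVert_length] at he
    cases he
  obtain ⟨s, hs⟩ := heven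
  have hlen := hc.three_le_length
  have hinj := hc.getVert_injOn'
  have hv (i : Fin (s + 1)) := (hpar (2 * i) (by omega)).1 (even_two_mul _)
  have he (i : Fin s) := (hpar (2 * i + 1) (by omega)).2 (by simp)
  choose v hv using hv
  choose e he using he
  have hvinj : Function.Injective (fun i : Fin s => v i.castSucc) := by
    intro i j hij
    have h1 : c.getVert (2 * i) = c.getVert (2 * j) := by
      have h2 := hv i.castSucc
      have h3 := hv j.castSucc
      simp only [Fin.val_castSucc] at h2 h3
      rw [h2, h3]; simpa using hij
    have := hinj (by show 2 * i.val ≤ c.length - 1; omega) (by show 2 * j.val ≤ c.length - 1; omega) h1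
    exact Fin.ext (by omega)
  have hlast : v 0 = v (Fin.last s) := by
    have h1 := hv 0
    have h2 := hv (Fin.last s)
    rw [Fin.val_last, show 2 * s = c.length by omega, c.getVert_length] at h2
    simp only [Fin.val_zero, mul_zero, c.getVert_zero] at h1
    exact Sum.inl_injective (h1.symm.trans h2)
  refine ⟨s, v, e, by omega, fun i => ⟨?_, ?_, fun hne => ?_⟩, fun i j hij => ?_, hvinj, hlast⟩
  · have hadj := c.adj_getVert_succ (i := 2 * i) (by omega)
    have h2 := hv i.castSucc
    simp only [Fin.val_castSucc] at h2
    rw [h2, he i] at hadj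
    simpa using hadj
  · have hadj := c.adj_getVert_succ (i := 2 * i + 1) (by omega)
    have h2 := hv i.succ
    rw [Fin.val_succ, show 2 * (i.val + 1) = 2 * i.val + 1 + 1 by ring] at h2
    rw [h2, he i] at hadj
    simpa using hadj
  -- In the closing step v_s = v_0, so equal ends would give i = 0 and s = 1, excluded by s ≥ 2.
  · by_cases hi : i.val + 1 = s
    · have h1 : i.succ = Fin.last s := Fin.ext (by simpa using hi)
      have h2 : v i.castSucc = v (Fin.castSucc ⟨0, by omega⟩) := by
        rw [hne, h1, ← hlast]; rfl
      have := Fin.ext_iff.mp (hvinj h2)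
      simp only at this
      omega
    · have h1 : i.succ = Fin.castSucc ⟨i.val + 1, by omega⟩ := rfl
      rw [h1] at hne
      have := Fin.ext_iff.mp (hvinj hne)
      simp only at this
      omega
  · have h1 : c.getVert (2 * i + 1) = c.getVert (2 * j + 1) := by rw [he i, he j, hij]
    have := hinj (by show 2 * i.val + 1 ≤ c.length - 1; omega)
      (by show 2 * j.val + 1 ≤ c.length - 1; omega) h1
    exact Fin.ext (by omega)

end Cycles

end Hypergraph

namespace Hypergraph

/-! ### Hypertrees and cut unicyclic hypergraphs as rooted trees -/

section Rooting

variable {V : Type*} {G : Hypergraph V} [Fintype G.vertexSet]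

lemma IsConnected.incidenceGraph_connected (hG : G.IsConnected)
    (hne : ∀ e, (G.ends e).Nonempty) (e₀ : G.edgeSet) :
    (incidenceGraph fun v e => v ∈ G.ends e).Connected := by
  set T := incidenceGraph fun v e => v ∈ G.ends e
  obtain ⟨v₀, -⟩ := hne e₀
  have hedge {v : G.vertexSet} {e : G.edgeSet} (h : v ∈ G.ends e) :
      T.Reachable (Sum.inl v) (Sum.inr e) :=
    SimpleGraph.Adj.reachable (incidenceGraph_adj_inl_inr.mpr h)
  have hV : {v | T.Reachable (Sum.inl v₀) (Sum.inl v)} = Set.univ :=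
    hG.eq_univ _ ⟨v₀, SimpleGraph.Reachable.refl _⟩ fun e u hu v hv h =>
      SimpleGraph.Reachable.trans h ((hedge hu).trans (hedge hv).symm)
  have hall : ∀ x, T.Reachable (Sum.inl v₀) x := by
    have hV' (v : G.vertexSet) : T.Reachable (Sum.inl v₀) (Sum.inl v) := by
      have : v ∈ {v | T.Reachable (Sum.inl v₀) (Sum.inl v)} := hV ▸ Set.mem_univ v
      exact this
    rintro (v | e)
    · exact hV' v
    · obtain ⟨v, hv⟩ := hne e
      exact (hV' v).trans (hedge hv)
  have : Nonempty (G.vertexSet ⊕ G.edgeSet) := ⟨Sum.inl v₀⟩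
  exact ⟨fun x y => (hall x).symm.trans (hall y)⟩

/-- If the incidence graph, or a part of it, has a cycle, then so has the hypergraph. -/
lemma exists_isCycle_of_not_isAcyclic {J : G.vertexSet → G.edgeSet → Prop}
    (hJ : ∀ v e, J v e → v ∈ G.ends e) (h : ¬ (incidenceGraph J).IsAcyclic) :
    ∃ (s : ℕ) (v : Fin (s + 1) → G.vertexSet) (e : Fin s → G.edgeSet),
      G.IsCycle s (fun i => v i) (fun i => e i) ∧
      ∀ i, J (v i.castSucc) (e i) ∧ J (v i.succ) (e i) := by
  obtain ⟨s, v, e, hs, hinc, he, hv, h0⟩ := exists_cycle_of_not_isAcyclic h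
  refine ⟨s, v, e, ⟨⟨(v 0).2, fun i => ⟨(e i).2, ?_, ?_, ?_⟩⟩, hs, ?_, ?_, ?_⟩,
    fun i => ⟨(hinc i).1, (hinc i).2.1⟩⟩
  · exact G.mem_ends.mp (hJ _ _ (hinc i).1)
  · exact G.mem_ends.mp (hJ _ _ (hinc i).2.1)
  · exact fun h => (hinc i).2.2 (Subtype.ext h)
  · exact Subtype.val_injective.comp he
  · exact Subtype.val_injective.comp hv
  · exact congrArg Subtype.val h0

lemma IsHypertree.exists_edgeRooted (hG : G.IsHypertree) (hne : ∀ e, (G.ends e).Nonempty)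
    (e₀ : G.edgeSet) : Nonempty (EdgeRooted (fun v e => v ∈ G.ends e) e₀) := by
  have : Nonempty G.vertexSet := ⟨(hne e₀).choose⟩
  refine Hypergraph.exists_edgeRooted ⟨hG.1.incidenceGraph_connected hne e₀, ?_⟩ e₀
  by_contra h
  obtain ⟨s, v, e, hcyc, -⟩ := exists_isCycle_of_not_isAcyclic (fun v e h => h) h
  exact hG.2 s _ _ hcyc

/-- Cutting one incidence on the cycle of a unicyclic hypergraph leaves a tree. -/
lemma IsUnicyclic.exists_edgeRooted (hG : G.IsUnicyclic) (hne : ∀ e, (G.ends e).Nonempty) :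
    ∃ (e₀ : G.edgeSet) (v₁ : G.vertexSet), v₁ ∈ G.ends e₀ ∧
      Nonempty (EdgeRooted (fun v e => v ∈ G.ends e ∧ ¬ (v = v₁ ∧ e = e₀)) e₀) := by
  obtain ⟨hconn, C, ⟨s, v, e, ⟨⟨-, hwalk⟩, hs, he, hv, hlast⟩, hC⟩, huniq⟩ := hG
  obtain ⟨s, rfl⟩ : ∃ t, s = t + 1 := ⟨s - 1, by omega⟩
  have hvmem (i : Fin (s + 2)) : v i ∈ G.vertexSet := by
    refine Fin.cases ?_ (fun j => ?_) i
    · exact G.mem_vertexSet_of_mem_edgeSet (hwalk 0).1 (hwalk 0).2.1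
    · exact G.mem_vertexSet_of_mem_edgeSet (hwalk j).1 (hwalk j).2.2.1
  set v' : Fin (s + 2) → G.vertexSet := fun i => ⟨v i, hvmem i⟩ with hv'
  set e' : Fin (s + 1) → G.edgeSet := fun i => ⟨e i, (hwalk i).1⟩ with he'
  have hinc1 (i : Fin (s + 1)) : v' i.castSucc ∈ G.ends (e' i) := G.mem_ends.mpr (hwalk i).2.1
  have hinc2 (i : Fin (s + 1)) : v' i.succ ∈ G.ends (e' i) := G.mem_ends.mpr (hwalk i).2.2.1
  refine ⟨e' 0, v' 1, hinc2 0, ?_⟩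
  have : Nonempty G.vertexSet := ⟨v' 1⟩
  set J : G.vertexSet → G.edgeSet → Prop := fun v e => v ∈ G.ends e ∧ ¬ (v = v' 1 ∧ e = e' 0)
    with hJ
  -- The rest of the cycle joins the two ends of the removed incidence, so connectedness survives.
  have hreach : (incidenceGraph J).Reachable (Sum.inl (v' 1)) (Sum.inr (e' 0)) := by
    have key : ∀ i : Fin (s + 1), (incidenceGraph J).Reachable (Sum.inl (v' 1))
        (Sum.inl (v' i.succ)) := by
      intro i
      induction i using Fin.induction with
      | zero => exact SimpleGraph.Reachable.refl _
      | succ i ih =>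
        have hne : e' i.succ ≠ e' 0 := fun h =>
          Fin.succ_ne_zero i (he (congrArg Subtype.val h))
        refine ih.trans (SimpleGraph.Reachable.trans (v := Sum.inr (e' i.succ)) ?_ ?_)
        · refine SimpleGraph.Adj.reachable (incidenceGraph_adj_inl_inr.mpr ⟨?_, fun h => hne h.2⟩)
          exact hinc1 i.succ
        · refine SimpleGraph.Adj.reachable (incidenceGraph_adj_inr_inl.mpr ⟨?_, fun h => hne h.2⟩)
          exact hinc2 i.succ
    refine (key (Fin.last s)).trans
      (SimpleGraph.Adj.reachable (incidenceGraph_adj_inl_inr.mpr ?_))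
    have h0 : v' (Fin.last s).succ = v' 0 := Subtype.ext hlast.symm
    rw [h0]
    refine ⟨hinc1 0, fun h => (hwalk 0).2.2.2 (congrArg Subtype.val h.1)⟩
  refine Hypergraph.exists_edgeRooted ⟨?_, ?_⟩ (e' 0)
  · have h1 := hconn.incidenceGraph_connected hne (e' 0)
    have hadj : ∀ x y, (incidenceGraph fun v e => v ∈ G.ends e).Adj x y →
        (incidenceGraph J).Reachable x y := by
      have hVE (u : G.vertexSet) (f : G.edgeSet) (huf : u ∈ G.ends f) :
          (incidenceGraph J).Reachable (Sum.inl u) (Sum.inr f) := by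
        by_cases h : u = v' 1 ∧ f = e' 0
        · rw [h.1, h.2]; exact hreach
        · exact SimpleGraph.Adj.reachable (incidenceGraph_adj_inl_inr.mpr ⟨huf, h⟩)
      rintro x y (⟨u, f, rfl, rfl, huf⟩ | ⟨u, f, rfl, rfl, huf⟩)
      · exact hVE u f huf
      · exact (hVE u f huf).symm
    have := h1.nonempty
    refine ⟨fun x y => ?_⟩
    obtain ⟨p⟩ := h1.preconnected x y
    induction p with
    | nil => exact SimpleGraph.Reachable.refl _
    | cons h p ih => exact (hadj _ _ h).trans ih
  -- A remaining cycle would be a cycle of G, hence the only one; but that one runs through the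
  -- removed incidence.
  · by_contra h
    obtain ⟨t, u, f, hcyc, hJuf⟩ := exists_isCycle_of_not_isAcyclic (fun v e h => h.1) h
    have h1 := huniq _ ⟨t, _, _, hcyc, rfl⟩
    have h2 : ((v 1, e 0) : V × Set V) ∈ C := by
      rw [hC]
      exact ⟨0, Or.inr rfl⟩
    rw [← h1] at h2
    obtain ⟨i, h3 | h3⟩ := h2
    · exact (hJuf i).1.2 ⟨Subtype.ext (congrArg Prod.fst h3).symm,
        Subtype.ext (congrArg Prod.snd h3).symm⟩
    · exact (hJuf i).2.2 ⟨Subtype.ext (congrArg Prod.fst h3).symm,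
        Subtype.ext (congrArg Prod.snd h3).symm⟩

end Rooting

end Hypergraph

namespace Hypergraph

/-! ### The extremal shapes up to isomorphism -/

section Predicates

variable {V E V' E' : Type*}

/-- All edges contain `w`, and every other vertex lies on exactly one edge. -/
def StarAt (I : E → Finset V) (w : V) : Prop :=
  (∀ e, w ∈ I e) ∧ ∀ v, v ≠ w → ∃! e, v ∈ I e

/-- All edges contain `w`, exactly two edges contain `u`, and every other vertex lies on exactly one
edge. -/
def CyclicStarAt (I : E → Finset V) (w u : V) : Prop :=
  w ≠ u ∧ (∀ e, w ∈ I e) ∧ (∃ e f, e ≠ f ∧ ∀ g, u ∈ I g ↔ g = e ∨ g = f) ∧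
    ∀ v, v ≠ w → v ≠ u → ∃! e, v ∈ I e

lemma StarAt.transfer {I : E → Finset V} {I' : E' → Finset V'} (φ : V ≃ V') (ψ : E ≃ E')
    (h : ∀ v e, v ∈ I e ↔ φ v ∈ I' (ψ e)) {w : V'} (hw : StarAt I' w) :
    StarAt I (φ.symm w) := by
  refine ⟨fun e => (h _ _).mpr (by simpa using hw.1 _), fun v hv => ?_⟩
  obtain ⟨e, he, huniq⟩ := hw.2 (φ v) (by rintro rfl; simp at hv)
  refine ⟨ψ.symm e, (h _ _).mpr (by simpa using he), fun f hf => ?_⟩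
  rw [← huniq _ ((h _ _).mp hf), ψ.symm_apply_apply]

lemma CyclicStarAt.transfer {I : E → Finset V} {I' : E' → Finset V'} (φ : V ≃ V') (ψ : E ≃ E')
    (h : ∀ v e, v ∈ I e ↔ φ v ∈ I' (ψ e)) {w u : V'} (hw : CyclicStarAt I' w u) :
    CyclicStarAt I (φ.symm w) (φ.symm u) := by
  obtain ⟨hne, hall, ⟨e, f, hef, hu⟩, hrest⟩ := hw
  refine ⟨fun h' => hne (φ.symm.injective h'), fun e => (h _ _).mpr (by simpa using hall _),
    ⟨ψ.symm e, ψ.symm f, fun h' => hef (ψ.symm.injective h'), fun g => ?_⟩, fun v hv hv' => ?_⟩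
  · rw [h, φ.apply_symm_apply, hu, Equiv.eq_symm_apply, Equiv.eq_symm_apply]
  · obtain ⟨e, he, huniq⟩ := hrest (φ v) (by rintro rfl; simp at hv) (by rintro rfl; simp at hv')
    refine ⟨ψ.symm e, (h _ _).mpr (by simpa using he), fun f hf => ?_⟩
    rw [← huniq _ ((h _ _).mp hf), ψ.symm_apply_apply]

lemma card_fiber_add_card [Fintype V] [DecidableEq V] [DecidableEq E] {I : E → Finset V} {k : ℕ}
    {e : E} (hI : (I e).card = k) {P : V → Prop} [DecidablePred P] {par : {v // ¬ P v} → E}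
    (h : ∀ v e, par v = e ↔ v.1 ∈ I e) :
    Fintype.card {v // par v = e} + Fintype.card {v : {v // P v} // v.1 ∈ I e} = k := by
  rw [← hI, ← Finset.card_filter_add_card_filter_not (s := I e) P, add_comm]
  congr 1
  · rw [← Fintype.card_coe]
    refine Fintype.card_congr ⟨fun v => ⟨v.1.1, by simp [v.2, v.1.2]⟩,
      fun v => ⟨⟨v.1, (Finset.mem_filter.mp v.2).2⟩, (Finset.mem_filter.mp v.2).1⟩,
      fun _ => rfl, fun _ => rfl⟩
  · rw [← Fintype.card_coe]
    refine Fintype.card_congr ⟨fun v => ⟨v.1.1, by simp [(h _ _).mp v.2, v.1.2]⟩,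
      fun v => ⟨⟨v.1, (Finset.mem_filter.mp v.2).2⟩,
        (h _ _).mpr (Finset.mem_filter.mp v.2).1⟩, fun _ => rfl, fun _ => rfl⟩

/-- Two uniform hypergraphs, in which the vertices outside `P` and `P'` have degree one, are
isomorphic if the incidences of the vertices in `P` and `P'` correspond to each other. -/
lemma exists_equiv_of_unique [Fintype V] [Fintype V'] {I : E → Finset V} {I' : E' → Finset V'}
    {k : ℕ} (hI : ∀ e, (I e).card = k) (hI' : ∀ e, (I' e).card = k) {P : V → Prop}
    {P' : V' → Prop} (φ₀ : {v // P v} ≃ {v // P' v}) (ψ : E ≃ E')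
    (h₀ : ∀ (v : {v // P v}) e, v.1 ∈ I e ↔ (φ₀ v).1 ∈ I' (ψ e))
    (hu : ∀ v, ¬ P v → ∃! e, v ∈ I e) (hu' : ∀ v, ¬ P' v → ∃! e, v ∈ I' e) :
    ∃ φ : V ≃ V', ∀ v e, v ∈ I e ↔ φ v ∈ I' (ψ e) := by
  classical
  choose par hpar using fun v : {v // ¬ P v} => (hu v v.2)
  choose par' hpar' using fun v : {v // ¬ P' v} => (hu' v v.2)
  have hmem (v : {v // ¬ P v}) (e : E) : par v = e ↔ v.1 ∈ I e :=
    ⟨fun h => h ▸ (hpar v).1, fun h => ((hpar v).2 e h).symm⟩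
  have hmem' (v : {v // ¬ P' v}) (e : E') : par' v = e ↔ v.1 ∈ I' e :=
    ⟨fun h => h ▸ (hpar' v).1, fun h => ((hpar' v).2 e h).symm⟩
  -- Corresponding edges have k vertices each and equally many special ones, hence equally many
  -- vertices of degree one.
  have hfib (e : E) : Nonempty ({v // par v = e} ≃ {v // par' v = ψ e}) := by
    refine ⟨Fintype.equivOfCardEq ?_⟩
    have h1 : Fintype.card {v : {v // P v} // v.1 ∈ I e} =
        Fintype.card {v : {v // P' v} // v.1 ∈ I' (ψ e)} :=
      Fintype.card_congr (φ₀.subtypeEquiv fun v => h₀ v e)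
    have h2 := card_fiber_add_card (hI e) hmem
    have h3 := card_fiber_add_card (hI' (ψ e)) hmem'
    omega
  let η := fun e => (hfib e).some
  set φ₁ : {v // ¬ P v} ≃ {v // ¬ P' v} := (Equiv.sigmaFiberEquiv par).symm.trans
    ((Equiv.sigmaCongr ψ η).trans (Equiv.sigmaFiberEquiv par')) with hφ₁
  have hφ (v : {v // ¬ P v}) : par' (φ₁ v) = ψ (par v) := (η (par v) ⟨v, rfl⟩).2
  refine ⟨(Equiv.sumCompl P).symm.trans ((Equiv.sumCongr φ₀ φ₁).trans (Equiv.sumCompl P')),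
    fun v e => ?_⟩
  by_cases hv : P v
  · rw [h₀ ⟨v, hv⟩ e]
    simp [Equiv.sumCompl_symm_apply_of_pos hv]
  · rw [← hmem ⟨v, hv⟩ e, ← ψ.injective.eq_iff, ← hφ, hmem']
    simp [Equiv.sumCompl_symm_apply_of_neg hv]

lemma StarAt.exists_equiv [Fintype V] [Fintype V'] [Fintype E] [Fintype E'] {I : E → Finset V}
    {I' : E' → Finset V'} {k : ℕ} (hI : ∀ e, (I e).card = k) (hI' : ∀ e, (I' e).card = k)
    (hE : Fintype.card E = Fintype.card E') {w : V} {w' : V'} (h : StarAt I w)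
    (h' : StarAt I' w') :
    ∃ (φ : V ≃ V') (ψ : E ≃ E'), ∀ v e, v ∈ I e ↔ φ v ∈ I' (ψ e) := by
  obtain ⟨φ, hφ⟩ := exists_equiv_of_unique hI hI' (P := fun v => v = w) (P' := fun v => v = w')
    (Equiv.ofUnique _ _) (Fintype.equivOfCardEq hE) (by
      rintro ⟨v, rfl⟩ e
      simp only [h.1 e, true_iff]
      rw [((Equiv.ofUnique {x // x = v} {x // x = w'}) ⟨v, rfl⟩).2]
      exact h'.1 _) h.2 h'.2
  exact ⟨φ, _, hφ⟩

lemma exists_equiv_pair [Fintype E] [Fintype E'] (hE : Fintype.card E = Fintype.card E') {e f : E}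
    {e' f' : E'} (hef : e ≠ f) (hef' : e' ≠ f') : ∃ ψ : E ≃ E', ψ e = e' ∧ ψ f = f' := by
  classical
  set ψ := Fintype.equivOfCardEq hE
  set χ := ψ.trans (Equiv.swap (ψ e) e')
  have h1 : χ e = e' := by simp [χ]
  -- The second swap leaves e' fixed, since e' is neither χ f nor f'.
  refine ⟨χ.trans (Equiv.swap (χ f) f'), ?_, by simp⟩
  rw [Equiv.trans_apply, h1, Equiv.swap_apply_of_ne_of_ne _ hef']
  intro h
  exact hef (χ.injective (h1.trans h))

lemma CyclicStarAt.exists_equiv [Fintype V] [Fintype V'] [Fintype E] [Fintype E']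
    {I : E → Finset V} {I' : E' → Finset V'} {k : ℕ} (hI : ∀ e, (I e).card = k)
    (hI' : ∀ e, (I' e).card = k) (hE : Fintype.card E = Fintype.card E') {w u : V} {w' u' : V'}
    (h : CyclicStarAt I w u) (h' : CyclicStarAt I' w' u') :
    ∃ (φ : V ≃ V') (ψ : E ≃ E'), ∀ v e, v ∈ I e ↔ φ v ∈ I' (ψ e) := by
  classical
  obtain ⟨hne, hall, ⟨e, f, hef, hu⟩, hrest⟩ := h
  obtain ⟨hne', hall', ⟨e', f', hef', hu'⟩, hrest'⟩ := h'
  obtain ⟨ψ, hψe, hψf⟩ := exists_equiv_pair hE hef hef'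
  set φ₀ : {v // v = w ∨ v = u} ≃ {v // v = w' ∨ v = u'} :=
    { toFun := fun v => if v.1 = w then ⟨w', Or.inl rfl⟩ else ⟨u', Or.inr rfl⟩
      invFun := fun v => if v.1 = w' then ⟨w, Or.inl rfl⟩ else ⟨u, Or.inr rfl⟩
      left_inv := by rintro ⟨v, rfl | rfl⟩ <;> simp [hne.symm, hne'.symm]
      right_inv := by rintro ⟨v, rfl | rfl⟩ <;> simp [hne.symm, hne'.symm] } with hφ₀
  obtain ⟨φ, hφ⟩ := exists_equiv_of_unique hI hI' φ₀ ψ (by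
      rintro ⟨v, rfl | rfl⟩ g
      · simp [hφ₀, hall, hall']
      · simp [hφ₀, hne.symm, hu, hu', ← hψe, ← hψf])
    (fun v hv => hrest v (fun h => hv (Or.inl h)) fun h => hv (Or.inr h))
    (fun v hv => hrest' v (fun h => hv (Or.inl h)) fun h => hv (Or.inr h))
  exact ⟨φ, _, hφ⟩

end Predicates

section Isomorphism

variable {V W : Type*} {G : Hypergraph V} {H : Hypergraph W} [Fintype G.vertexSet]
  [Fintype H.vertexSet]

lemma Isomorphic.of_equiv (φ : G.vertexSet ≃ H.vertexSet) (ψ : G.edgeSet ≃ H.edgeSet)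
    (h : ∀ v e, v ∈ G.ends e ↔ φ v ∈ H.ends (ψ e)) : G.Isomorphic H := by
  refine ⟨φ, fun s => ⟨fun hs => ?_, fun hs => ?_⟩⟩
  · convert! (ψ ⟨_, hs⟩).2
    ext x
    constructor
    · rintro ⟨_, ⟨v, hv, rfl⟩, rfl⟩
      exact H.mem_ends.mp ((h v _).mp (G.mem_ends.mpr ⟨v, hv, rfl⟩))
    · intro hx
      have hx' := H.mem_vertexSet_of_mem_edgeSet (ψ ⟨_, hs⟩).2 hx
      obtain ⟨v, hv⟩ := φ.surjective ⟨x, hx'⟩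
      have h1 := G.mem_ends.mp ((h v ⟨_, hs⟩).mpr (H.mem_ends.mpr (by rw [hv]; exact hx)))
      obtain ⟨v', hv', h2⟩ := h1
      exact ⟨φ v, ⟨v, Subtype.ext h2 ▸ hv', rfl⟩, by rw [hv]⟩
  · convert! (ψ.symm ⟨_, hs⟩).2
    ext x
    constructor
    · rintro ⟨v, hv, rfl⟩
      refine G.mem_ends.mp ((h v _).mpr (H.mem_ends.mpr ?_))
      rw [ψ.apply_symm_apply]
      exact ⟨_, ⟨v, hv, rfl⟩, rfl⟩
    · intro hx
      have hx' := G.mem_vertexSet_of_mem_edgeSet (ψ.symm ⟨_, hs⟩).2 hx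
      have h1 := H.mem_ends.mp ((h ⟨x, hx'⟩ _).mp (G.mem_ends.mpr hx))
      rw [ψ.apply_symm_apply] at h1
      obtain ⟨_, ⟨v, hv, rfl⟩, h2⟩ := h1
      exact ⟨v, hv, congrArg Subtype.val (φ.injective (Subtype.ext h2))⟩

lemma Isomorphic.exists_equiv (h : G.Isomorphic H) :
    ∃ (φ : G.vertexSet ≃ H.vertexSet) (ψ : G.edgeSet ≃ H.edgeSet),
      ∀ v e, v ∈ G.ends e ↔ φ v ∈ H.ends (ψ e) := by
  obtain ⟨φ, hφ⟩ := h
  have hG (e : G.edgeSet) : Subtype.val '' (φ '' (G.ends e : Set G.vertexSet)) ∈ H.edgeSet := by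
    rw [← hφ, G.coe_image_ends]; exact e.2
  have hψ : Function.Bijective
      fun e : G.edgeSet => (⟨_, hG e⟩ : H.edgeSet) := by
    constructor
    · intro e f hef
      have h1 := congrArg Subtype.val hef
      have h2 := φ.injective.image_injective (Subtype.val_injective.image_injective h1)
      exact G.ends_injective (Finset.coe_injective h2)
    · intro f
      have h1 : Subtype.val '' (φ '' (φ.symm '' (H.ends f : Set H.vertexSet))) = f := by
        rw [← Set.image_comp φ]
        simp [H.coe_image_ends]
      have h2 : Subtype.val '' (φ.symm '' (H.ends f : Set H.vertexSet)) ∈ G.edgeSet := by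
        rw [hφ, h1]; exact f.2
      refine ⟨⟨_, h2⟩, Subtype.ext ?_⟩
      rw [← h1]
      have h3 := G.coe_image_ends ⟨_, h2⟩
      have h4 := Subtype.val_injective.image_injective h3
      simp only
      rw [h4]
  refine ⟨φ, Equiv.ofBijective _ hψ, fun v e => ?_⟩
  simp

end Isomorphism

end Hypergraph

namespace Hypergraph

/-! ### Positive eigenvectors of the extremal hypergraphs -/

section Eigenvectors

variable {V : Type*} {G : Hypergraph V} [Fintype G.vertexSet] [Fintype G.edgeSet]

lemma card_filter_eq_one {V E : Type*} [Fintype E] [DecidableEq V] {I : E → Finset V} {v : V}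
    (h : ∃! e, v ∈ I e) : ∃ e, v ∈ I e ∧ (Finset.univ.filter fun e => v ∈ I e) = {e} := by
  obtain ⟨e, he, huniq⟩ := h
  refine ⟨e, he, ?_⟩
  ext f
  simp only [Finset.mem_filter, Finset.mem_univ, true_and, Finset.mem_singleton]
  exact ⟨fun hf => huniq f hf, fun hf => hf ▸ he⟩

/-- The `α`-spectral radius of a hyperstar. -/
lemma StarAt.alphaSpectralRadius_eq {k : ℕ} (hk : 2 ≤ k) (hG : G.IsUniform k) {α β p q : ℝ}
    (hα0 : 0 ≤ α) (hα1 : α < 1) (hβ : α = (1 - α) * β) (hq0 : 0 < q)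
    (hq : q + β = Fintype.card G.edgeSet * (p + β)) (hpq : p * q ^ (k - 1) = 1)
    {w : G.vertexSet} (hw : StarAt G.ends w) :
    G.alphaSpectralRadius k α = (1 - α) * q + α := by
  classical
  have hα : 0 < 1 - α := by linarith
  have : Nonempty G.vertexSet := ⟨w⟩
  have hP (e : G.edgeSet) : ∏ u ∈ G.ends e, (if u = w then q else 1) = q := by
    rw [Finset.prod_ite_eq' (G.ends e) w fun _ => q, if_pos (hw.1 e)]
  have hpk : p * q ^ k = q := by
    rw [show k = (k - 1) + 1 by omega, pow_succ]
    linear_combination q * hpq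
  refine G.alphaSpectralRadius_eq (by omega) hG hα0 hα1 (x := fun v => if v = w then q else 1)
    (fun v => by split_ifs <;> positivity) (by positivity) fun v => ?_
  simp only [hP, Finset.sum_const, nsmul_eq_mul]
  by_cases hv : v = w
  · subst hv
    have h1 : (Finset.univ.filter fun e => v ∈ G.ends e) = Finset.univ := by
      ext e; simpa using hw.1 e
    simp only [h1, Finset.card_univ, if_true]
    linear_combination (-(1 - α) * q ^ k) * hq + (1 - (Fintype.card G.edgeSet : ℝ)) * q ^ k * (-hβ)
      - (1 - α) * Fintype.card G.edgeSet * hpk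
  · obtain ⟨e, -, h1⟩ := card_filter_eq_one (hw.2 v hv)
    simp only [h1, Finset.card_singleton, if_neg hv]
    simp
    ring

/-- The `α`-spectral radius of the extremal unicyclic hypergraph. -/
lemma CyclicStarAt.alphaSpectralRadius_eq {k : ℕ} (hk : 3 ≤ k) (hG : G.IsUniform k)
    {α β p q θ : ℝ} (hα0 : 0 ≤ α) (hα1 : α < 1) (hβ : α = (1 - α) * β) (hq0 : 0 < q)
    (hθ0 : 0 < θ) (hθ : θ ^ k * (q - β) = 2 * q)
    (hq : q - β = 2 * (p * θ ^ k) + (p + β) * (Fintype.card G.edgeSet - 2))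
    (hpq : p * q ^ (k - 1) = 1) {w u : G.vertexSet} (hw : CyclicStarAt G.ends w u) :
    G.alphaSpectralRadius k α = (1 - α) * q + α := by
  classical
  obtain ⟨hne, hall, ⟨e₁, e₂, he₁₂, hu⟩, hrest⟩ := hw
  have hα : 0 < 1 - α := by linarith
  have : Nonempty G.vertexSet := ⟨w⟩
  have hpk : p * q ^ k = q := by
    rw [show k = (k - 1) + 1 by omega, pow_succ]
    linear_combination q * hpq
  -- The product is q θ^k on the two cycle edges and q on the others. The resulting labels are p θ^k
  -- = p' or p at w, q/θ^k = (q-β)/2 at u, and q elsewhere.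
  obtain ⟨x, hx⟩ : ∃ x : G.vertexSet → ℝ, ∀ v, x v = if v = w then q else if v = u then θ ^ 2 else
    if ∃ e, v ∈ G.ends e ∧ u ∈ G.ends e then θ else 1 := ⟨_, fun _ => rfl⟩
  have hxw : x w = q := by rw [hx, if_pos rfl]
  have hxu : x u = θ ^ 2 := by rw [hx, if_neg hne.symm, if_pos rfl]
  have hxv {v : G.vertexSet} {e : G.edgeSet} (hv : v ∈ G.ends e) (h1 : v ≠ w) (h2 : v ≠ u) :
      x v = if u ∈ G.ends e then θ else 1 := by
    rw [hx, if_neg h1, if_neg h2]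
    congr 1
    refine propext ⟨fun ⟨f, hf, hf'⟩ => ?_, fun h => ⟨e, hv, h⟩⟩
    rwa [(hrest v h1 h2).unique hv hf]
  have hP (e : G.edgeSet) :
      ∏ v ∈ G.ends e, x v = if u ∈ G.ends e then q * θ ^ k else q := by
    rw [← Finset.mul_prod_erase _ _ (hall e), hxw]
    split_ifs with hue
    · have hue' : u ∈ (G.ends e).erase w := Finset.mem_erase.mpr ⟨hne.symm, hue⟩
      rw [← Finset.mul_prod_erase _ _ hue', hxu, Finset.prod_congr rfl (g := fun _ => θ),
        Finset.prod_const, Finset.card_erase_of_mem hue', Finset.card_erase_of_mem (hall e),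
        G.card_ends hG, ← pow_add, show 2 + (k - 1 - 1) = k by omega]
      intro v hv
      obtain ⟨h2, hv⟩ := Finset.mem_erase.mp hv
      obtain ⟨h1, hv⟩ := Finset.mem_erase.mp hv
      rw [hxv hv h1 h2, if_pos hue]
    · rw [Finset.prod_eq_one, mul_one]
      intro v hv
      obtain ⟨h1, hv⟩ := Finset.mem_erase.mp hv
      rw [hxv hv h1 (by rintro rfl; exact hue hv), if_neg hue]
  have hfu : (Finset.univ.filter fun e => u ∈ G.ends e) = {e₁, e₂} := by
    ext e; simp [hu]
  refine G.alphaSpectralRadius_eq (by omega) hG hα0 hα1 (x := x)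
    (fun v => by rw [hx]; split_ifs <;> positivity) (by positivity) fun v => ?_
  by_cases hv : v = w
  · subst hv
    have h1 : (Finset.univ.filter fun e => v ∈ G.ends e) = Finset.univ := by
      ext e; simpa using hall e
    have h2 : ∑ e, ∏ u ∈ G.ends e, x u =
        2 * (q * θ ^ k) + (Fintype.card G.edgeSet - 2) * q := by
      have h3 : ∀ e : G.edgeSet, (if u ∈ G.ends e then q * θ ^ k else q) =
          q + if u ∈ G.ends e then q * θ ^ k - q else 0 := fun e => by split_ifs <;> ring
      simp only [hP, h3]
      rw [Finset.sum_add_distrib, ← Finset.sum_filter, hfu, Finset.sum_pair he₁₂]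
      simp only [Finset.sum_const, Finset.card_univ, nsmul_eq_mul]
      ring
    rw [h1, h2, hxw, Finset.card_univ]
    linear_combination (-(1 - α) * q ^ k) * hq + (Fintype.card G.edgeSet - 1 : ℝ) * q ^ k * hβ
      - (1 - α) * (2 * θ ^ k + (Fintype.card G.edgeSet - 2)) * hpk
  · by_cases hvu : v = u
    · subst hvu
      rw [hfu, Finset.sum_pair he₁₂, hP, hP, if_pos ((hu _).mpr (Or.inl rfl)),
        if_pos ((hu _).mpr (Or.inr rfl)), Finset.card_pair he₁₂, hxu]
      push_cast
      linear_combination (-(1 - α) * θ ^ k) * hθ + θ ^ k * θ ^ k * hβ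
    · obtain ⟨e, he, h1⟩ := card_filter_eq_one (hrest v hv hvu)
      rw [h1, Finset.sum_singleton, hP, Finset.card_singleton, hxv he hv hvu]
      split_ifs <;> push_cast <;> ring

end Eigenvectors

/-! ### Existence of the parameters -/

section Roots

/-- The equation for the `α`-spectral radius of a hyperstar has a positive solution. -/
lemma exists_star_root (n : ℕ) {m β : ℝ} (hm : 1 ≤ m) (hβ : 0 ≤ β) :
    ∃ p q : ℝ, 0 < p ∧ 0 < q ∧ q + β = m * (p + β) ∧ p * q ^ n = 1 := by
  have hcont : ContinuousOn (fun q : ℝ => q + β - m * ((q ^ n)⁻¹ + β)) (Set.Icc 1 (m * (1 + β))) := by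
    have h : ContinuousOn (fun q : ℝ => (q ^ n)⁻¹) (Set.Icc 1 (m * (1 + β))) :=
      (continuous_pow n).continuousOn.inv₀ fun q hq => (pow_pos (by linarith [hq.1]) n).ne'
    fun_prop
  have h1 : 1 ≤ m * (1 + β) := by nlinarith
  have h0 : (0 : ℝ) ∈ Set.Icc (1 + β - m * (((1 : ℝ) ^ n)⁻¹ + β))
      (m * (1 + β) + β - m * (((m * (1 + β)) ^ n)⁻¹ + β)) := by
    constructor
    · rw [one_pow, inv_one]; nlinarith
    · have : ((m * (1 + β)) ^ n)⁻¹ ≤ 1 := inv_le_one_of_one_le₀ (one_le_pow₀ h1)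
      nlinarith
  obtain ⟨q, hq, hq0⟩ := intermediate_value_Icc h1 hcont h0
  have hq1 : 0 < q := by linarith [hq.1]
  have hqn : 0 < q ^ n := pow_pos hq1 n
  refine ⟨(q ^ n)⁻¹, q, inv_pos.mpr hqn, hq1, ?_, inv_mul_cancel₀ hqn.ne'⟩
  simp only at hq0
  linarith

/-- The equation for the `α`-spectral radius of the extremal unicyclic hypergraph has a positive
solution. -/
lemma exists_cyclicStar_root {k : ℕ} (hk : 3 ≤ k) {m β : ℝ} (hm : 2 ≤ m) (hβ : 0 ≤ β) :
    ∃ p q θ : ℝ, 0 < p ∧ 0 < q ∧ 0 < θ ∧ θ ^ k * (q - β) = 2 * q ∧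
      q - β = 2 * (p * θ ^ k) + (p + β) * (m - 2) ∧ p * q ^ (k - 1) = 1 := by
  set n := k - 1
  -- Substituting θ^k = 2q/(q-β) and p = q^(-n) and multiplying by q - β gives the function used
  -- here. At q = β it is negative when β > 0; for β = 0 the point 1 avoids the pole at 0.
  obtain ⟨a, ha0, haβ, ha⟩ : ∃ a : ℝ, 0 < a ∧ β ≤ a ∧
      (a - β) * (a - β - ((a ^ n)⁻¹ + β) * (m - 2)) - 4 * (a ^ n)⁻¹ * a < 0 := by
    rcases hβ.eq_or_lt with rfl | hβ0
    · refine ⟨1, one_pos, zero_le_one, ?_⟩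
      rw [one_pow, inv_one]; nlinarith
    · refine ⟨β, hβ0, le_rfl, ?_⟩
      have : 0 < (β ^ n)⁻¹ := inv_pos.mpr (pow_pos hβ0 n)
      have := mul_pos this hβ0
      nlinarith
  set b : ℝ := max a (β + (1 + β) * (m - 2) + (8 + 4 * β)) with hb
  have hab : a ≤ b := le_max_left _ _
  have hbb : β + (1 + β) * (m - 2) + (8 + 4 * β) ≤ b := le_max_right _ _
  have hcont : ContinuousOn (fun q : ℝ => (q - β) * (q - β - ((q ^ n)⁻¹ + β) * (m - 2)) -
      4 * (q ^ n)⁻¹ * q) (Set.Icc a b) := by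
    have h : ContinuousOn (fun q : ℝ => (q ^ n)⁻¹) (Set.Icc a b) :=
      (continuous_pow n).continuousOn.inv₀ fun q hq => (pow_pos (by linarith [hq.1]) n).ne'
    fun_prop
  have hy : 0 ≤ (1 + β) * (m - 2) := mul_nonneg (by linarith) (by linarith)
  have hfb : 0 ≤ (b - β) * (b - β - ((b ^ n)⁻¹ + β) * (m - 2)) - 4 * (b ^ n)⁻¹ * b := by
    have h1 : (b ^ n)⁻¹ ≤ 1 := inv_le_one_of_one_le₀ (one_le_pow₀ (by linarith))
    have h2 : ((b ^ n)⁻¹ + β) * (m - 2) ≤ (1 + β) * (m - 2) :=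
      mul_le_mul_of_nonneg_right (by linarith) (by linarith)
    have h3 : (b - β) * (b - β - (1 + β) * (m - 2)) ≤
        (b - β) * (b - β - ((b ^ n)⁻¹ + β) * (m - 2)) :=
      mul_le_mul_of_nonneg_left (by linarith) (by linarith)
    have h4 : (b - β) * (8 + 4 * β) ≤ (b - β) * (b - β - (1 + β) * (m - 2)) :=
      mul_le_mul_of_nonneg_left (by linarith) (by linarith)
    have h5 : 4 * (b ^ n)⁻¹ * b ≤ 4 * b := by nlinarith
    have h6 : (8 : ℝ) * (4 + 4 * β) ≤ (b - β) * (4 + 4 * β) :=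
      mul_le_mul_of_nonneg_right (by linarith) (by linarith)
    linarith
  obtain ⟨q, hq, hq0⟩ := intermediate_value_Icc hab hcont ⟨ha.le, hfb⟩
  simp only at hq0
  have hq1 : 0 < q := by linarith [hq.1]
  have hqn : 0 < (q ^ n)⁻¹ := inv_pos.mpr (pow_pos hq1 n)
  have hqβ : 0 < q - β := by
    refine lt_of_le_of_ne (by linarith [hq.1]) fun h => ?_
    rw [← h] at hq0
    have := mul_pos hqn hq1
    linarith
  have hθ0 : 0 < 2 * q / (q - β) := by positivity
  have hθk : ((2 * q / (q - β)) ^ ((k : ℝ)⁻¹)) ^ k = 2 * q / (q - β) :=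
    Real.rpow_inv_natCast_pow hθ0.le (by omega)
  refine ⟨(q ^ n)⁻¹, q, (2 * q / (q - β)) ^ ((k : ℝ)⁻¹), hqn, hq1, Real.rpow_pos_of_pos hθ0 _,
    by rw [hθk, div_mul_cancel₀ _ hqβ.ne'], ?_, inv_mul_cancel₀ (pow_pos hq1 n).ne'⟩
  rw [hθk]
  refine mul_left_cancel₀ hqβ.ne' ?_
  have h1 : (q - β) * (2 * ((q ^ n)⁻¹ * (2 * q / (q - β))) + ((q ^ n)⁻¹ + β) * (m - 2)) =
      4 * (q ^ n)⁻¹ * q + (q - β) * (((q ^ n)⁻¹ + β) * (m - 2)) := by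
    field_simp
    ring
  rw [h1]
  linarith

end Roots

end Hypergraph

namespace Hypergraph

/-! ### Connectedness and cycles of the extremal shapes -/

section Combinatorics

variable {V : Type*} {G : Hypergraph V}

lemma isConnected_of_center {c : V} (hc : ∀ e ∈ G.edgeSet, c ∈ e)
    (h : ∀ v ∈ G.vertexSet, v ≠ c → ∃ e ∈ G.edgeSet, v ∈ e) : G.IsConnected := by
  intro u hu w hw
  by_cases huw : u = w
  · subst huw
    exact ⟨0, fun _ => u, Fin.elim0, ⟨⟨hu, fun i => i.elim0⟩, fun i j _ => Subsingleton.elim (α := Fin 1) i j,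
      fun i => i.elim0⟩, rfl, rfl⟩
  by_cases he : ∃ e ∈ G.edgeSet, u ∈ e ∧ w ∈ e
  · obtain ⟨e, he, hue, hwe⟩ := he
    refine ⟨1, ![u, w], fun _ => e, ⟨⟨hu, fun i => ?_⟩, ?_, fun i j _ => Subsingleton.elim _ _⟩,
      rfl, rfl⟩
    · fin_cases i
      exact ⟨he, hue, hwe, huw⟩
    · intro i j hij
      fin_cases i <;> fin_cases j <;> simp_all
  · have huc : u ≠ c := by
      rintro rfl
      obtain ⟨e, he', hwe⟩ := h w hw (Ne.symm huw)
      exact he ⟨e, he', hc e he', hwe⟩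
    have hwc : w ≠ c := by
      rintro rfl
      obtain ⟨e, he', hue⟩ := h u hu huw
      exact he ⟨e, he', hue, hc e he'⟩
    obtain ⟨e, he', hue⟩ := h u hu huc
    obtain ⟨f, hf', hwf⟩ := h w hw hwc
    have hef : e ≠ f := by
      rintro rfl
      exact he ⟨e, he', hue, hwf⟩
    refine ⟨2, ![u, c, w], ![e, f], ⟨⟨hu, fun i => ?_⟩, ?_, ?_⟩, rfl, rfl⟩
    · fin_cases i
      · exact ⟨he', hue, hc e he', huc⟩
      · exact ⟨hf', hc f hf', hwf, hwc.symm⟩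
    · intro i j hij
      fin_cases i <;> fin_cases j <;> simp_all [eq_comm]
    · intro i j hij
      fin_cases i <;> fin_cases j <;> simp_all [eq_comm]

/-- Every vertex of a cycle lies on two edges. -/
lemma IsCycle.exists_two_edges {s : ℕ} {v : Fin (s + 1) → V} {e : Fin s → Set V}
    (h : G.IsCycle s v e) (i : Fin s) :
    ∃ e' ∈ G.edgeSet, ∃ f ∈ G.edgeSet, e' ≠ f ∧ v i.castSucc ∈ e' ∧ v i.castSucc ∈ f := by
  obtain ⟨⟨-, hwalk⟩, hs, he, -, h0⟩ := h
  obtain ⟨s, rfl⟩ : ∃ t, s = t + 1 := ⟨s - 1, by omega⟩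
  cases i using Fin.cases with
  | zero =>
    refine ⟨e 0, (hwalk 0).1, e (Fin.last s), (hwalk _).1, fun h => ?_, (hwalk 0).2.1, ?_⟩
    · have := Fin.ext_iff.mp (he h)
      simp at this
      omega
    · have h1 := (hwalk (Fin.last s)).2.2.1
      rw [Fin.succ_last, ← h0] at h1
      exact h1
  | succ i =>
    refine ⟨e i.succ, (hwalk _).1, e i.castSucc, (hwalk _).1, fun h => ?_, (hwalk _).2.1, ?_⟩
    · have := Fin.ext_iff.mp (he h)
      simp at this
    · exact (hwalk i.castSucc).2.2.1

variable [Fintype G.vertexSet]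

/-- Every cycle vertex lies on two edges, so it must be w, but a cycle has at least two distinct
vertices. -/
lemma StarAt.isHypertree {w : G.vertexSet} (h : StarAt G.ends w) : G.IsHypertree := by
  refine ⟨isConnected_of_center (c := w) (fun e he => G.mem_ends.mp (h.1 ⟨e, he⟩))
    fun v hv hne => ?_, fun s v e hcyc => ?_⟩
  · obtain ⟨e, he, -⟩ := h.2 ⟨v, hv⟩ fun h' => hne (congrArg Subtype.val h')
    exact ⟨e, e.2, G.mem_ends.mp he⟩
  · have key (i : Fin s) : v i.castSucc = w := by
      obtain ⟨e', he', f, hf, hne, h1, h2⟩ := hcyc.exists_two_edges i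
      by_contra hw
      have hmem := G.mem_vertexSet_of_mem_edgeSet he' h1
      have h3 := (h.2 ⟨_, hmem⟩ fun h' => hw (congrArg Subtype.val h')).unique
        (y₁ := ⟨e', he'⟩) (y₂ := ⟨f, hf⟩) (G.mem_ends.mpr h1) (G.mem_ends.mpr h2)
      exact hne (congrArg Subtype.val h3)
    obtain ⟨-, hs, -, hinj, -⟩ := hcyc
    have h1 := hinj ((key ⟨0, by omega⟩).trans (key ⟨1, by omega⟩).symm)
    simp at h1

/-- Only w and u lie on two edges, so a cycle has length 2 and uses the two edges at u. As a set of
incidences it consists of all four pairs, whatever its start and direction. -/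
lemma CyclicStarAt.isUnicyclic {w u : G.vertexSet} (h : CyclicStarAt G.ends w u) :
    G.IsUnicyclic := by
  obtain ⟨hne, hall, ⟨e₁, e₂, he₁₂, hu⟩, hrest⟩ := h
  have hw (e : G.edgeSet) : (w : V) ∈ (e : Set V) := G.mem_ends.mp (hall e)
  have hu1 : (u : V) ∈ (e₁ : Set V) := G.mem_ends.mp ((hu _).mpr (Or.inl rfl))
  have hu2 : (u : V) ∈ (e₂ : Set V) := G.mem_ends.mp ((hu _).mpr (Or.inr rfl))
  have hwu : (w : V) ≠ u := fun h => hne (Subtype.ext h)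
  have he : (e₁ : Set V) ≠ e₂ := fun h => he₁₂ (Subtype.ext h)
  refine ⟨isConnected_of_center (c := w) (fun e he => hw ⟨e, he⟩) fun v hv hvw => ?_,
    ({(w : V), (u : V)} : Set V) ×ˢ ({(e₁ : Set V), (e₂ : Set V)} : Set (Set V)), ?_, ?_⟩
  · by_cases hvu : v = u
    · exact ⟨e₁, e₁.2, hvu ▸ hu1⟩
    · obtain ⟨e, he, -⟩ := hrest ⟨v, hv⟩ (fun h' => hvw (congrArg Subtype.val h'))
        fun h' => hvu (congrArg Subtype.val h')
      exact ⟨e, e.2, G.mem_ends.mp he⟩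
  · refine ⟨2, ![w, u, w], ![e₁, e₂], ⟨⟨w.2, fun i => ?_⟩, le_rfl, ?_, ?_, rfl⟩, ?_⟩
    · fin_cases i
      · exact ⟨e₁.2, hw _, hu1, hwu⟩
      · exact ⟨e₂.2, hu2, hw _, hwu.symm⟩
    · intro i j hij
      fin_cases i <;> fin_cases j <;> simp_all [eq_comm]
    · intro i j hij
      fin_cases i <;> fin_cases j <;> simp_all [eq_comm]
    · ext ⟨x, y⟩
      simp [Fin.exists_fin_two]
      tauto
  · rintro C ⟨s, v, e, hcyc, hC⟩
    have key (i : Fin s) : v i.castSucc = w ∨ v i.castSucc = u := by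
      obtain ⟨e', he', f, hf, hef, h1, h2⟩ := hcyc.exists_two_edges i
      by_contra hwu
      push Not at hwu
      have hmem := G.mem_vertexSet_of_mem_edgeSet he' h1
      have h3 := (hrest ⟨_, hmem⟩ (fun h' => hwu.1 (congrArg Subtype.val h'))
        fun h' => hwu.2 (congrArg Subtype.val h')).unique
        (y₁ := ⟨e', he'⟩) (y₂ := ⟨f, hf⟩) (G.mem_ends.mpr h1) (G.mem_ends.mpr h2)
      exact hef (congrArg Subtype.val h3)
    obtain ⟨⟨-, hwalk⟩, hs, heinj, hinj, h0⟩ := hcyc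
    have hs2 : s = 2 := by
      by_contra hs'
      have h01 : ¬ v (Fin.castSucc ⟨0, by omega⟩) = v (Fin.castSucc ⟨1, by omega⟩) := fun h => by
        have := hinj h
        simp at this
      have h02 : ¬ v (Fin.castSucc ⟨0, by omega⟩) = v (Fin.castSucc ⟨2, by omega⟩) := fun h => by
        have := hinj h
        simp at this
      have h12 : ¬ v (Fin.castSucc ⟨1, by omega⟩) = v (Fin.castSucc ⟨2, by omega⟩) := fun h => by
        have := hinj h
        simp at this
      have k0 := key ⟨0, by omega⟩
      have k1 := key ⟨1, by omega⟩
      have k2 := key ⟨2, by omega⟩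
      grind
    subst hs2
    obtain ⟨he0, hv0, hv1, hv01⟩ := hwalk 0
    obtain ⟨he1, hv1', hv2, -⟩ := hwalk 1
    simp only [Fin.castSucc_zero, Fin.succ_zero_eq_one] at hv0 hv1 hv01
    simp only [Fin.castSucc_one, Fin.succ_one_eq_two] at hv1' hv2
    have h20 : v 2 = v 0 := h0.symm
    have k0 : v 0 = w ∨ v 0 = u := key 0
    have k1 : v 1 = w ∨ v 1 = u := key 1
    rw [h20] at hv2
    have hue0 : (u : V) ∈ e 0 := by grind
    have hue1 : (u : V) ∈ e 1 := by grind
    have m0 := (hu ⟨_, he0⟩).mp (G.mem_ends.mpr hue0)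
    have m1 := (hu ⟨_, he1⟩).mp (G.mem_ends.mpr hue1)
    simp only [Subtype.ext_iff] at m0 m1
    have h01 : e 0 ≠ e 1 := fun h => by simpa using heinj h
    rw [hC]
    ext ⟨x, y⟩
    simp only [Fin.exists_fin_two, Set.mem_ofPred_eq, Prod.mk.injEq, Set.mem_prod,
      Set.mem_insert_iff, Set.mem_singleton_iff, Fin.castSucc_zero, Fin.succ_zero_eq_one,
      Fin.castSucc_one, Fin.succ_one_eq_two, h20]
    grind

end Combinatorics

/-! ### The models of the hyperstar and of H_{m,1,k} -/

section Concrete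

lemma hyperstar_edge_injective {m k : ℕ} (hk : 2 ≤ k) : Function.Injective fun i : Fin m =>
    (insert none (Set.range fun j : Fin (k - 1) => some (i, j)) :
      Set (Option (Fin m × Fin (k - 1)))) := by
  intro i i' h
  have h1 : (some (i, ⟨0, by omega⟩) : Option (Fin m × Fin (k - 1))) ∈
      (insert none (Set.range fun j : Fin (k - 1) => some (i, j)) :
        Set (Option (Fin m × Fin (k - 1)))) := Or.inr ⟨_, rfl⟩
  simp only at h
  rw [h] at h1
  rcases h1 with h1 | ⟨j, h1⟩
  · cases h1
  · exact (congrArg Prod.fst (Option.some_injective _ h1)).symm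

lemma hyperstar_isUniform {m k : ℕ} (hk : 2 ≤ k) : (hyperstar m k).IsUniform k := by
  rintro _ ⟨i, rfl⟩
  rw [Set.ncard_insert_of_notMem (by simp), ← Set.image_univ, Set.ncard_image_of_injective,
    Set.ncard_univ, Nat.card_fin]
  · omega
  · intro j j' h; simpa using h

lemma hyperstar_ncard {m k : ℕ} (hk : 2 ≤ k) : (hyperstar m k).edgeSet.ncard = m := by
  show (Set.range _).ncard = m
  rw [← Set.image_univ, Set.ncard_image_of_injective _ (hyperstar_edge_injective hk),
    Set.ncard_univ, Nat.card_fin]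

lemma hyperstar_starAt (m k : ℕ) : StarAt (hyperstar m k).ends ⟨none, trivial⟩ := by
  constructor
  · rintro ⟨_, i, rfl⟩
    exact (mem_ends _).mpr (Or.inl rfl)
  · rintro ⟨_ | ⟨i, j⟩, hv⟩ hne
    · exact absurd rfl hne
    · refine ⟨⟨_, i, rfl⟩, (mem_ends _).mpr (Or.inr ⟨j, rfl⟩), ?_⟩
      rintro ⟨_, i', rfl⟩ h
      rcases (mem_ends _).mp h with h1 | ⟨j', h1⟩
      · cases h1
      · obtain rfl : i' = i := congrArg Prod.fst (Option.some_injective _ h1)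
        rfl

open CyclicStarVertex

/-- The edges of the extremal unicyclic hypergraph. -/
def cyclicStarEdge (m k : ℕ) : Fin 2 ⊕ Fin (m - 2 * 1) → Set (CyclicStarVertex m 1 k)
  | Sum.inl b => {center, second 0} ∪ Set.range (onCycle 0 b)
  | Sum.inr i => {center} ∪ Set.range (onPendant i)

lemma cyclicStar_edgeSet (m k : ℕ) :
    (cyclicStar m 1 k).edgeSet = Set.range (cyclicStarEdge m k) := by
  ext e
  constructor
  · rintro (⟨⟨c, b⟩, rfl⟩ | ⟨i, rfl⟩)
    · rw [Subsingleton.elim c 0]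
      exact ⟨Sum.inl b, rfl⟩
    · exact ⟨Sum.inr i, rfl⟩
  · rintro ⟨b | i, rfl⟩
    · exact Or.inl ⟨(0, b), rfl⟩
    · exact Or.inr ⟨i, rfl⟩

variable {m k : ℕ}

lemma second_mem_cyclicStarEdge {x : Fin 2 ⊕ Fin (m - 2 * 1)} :
    (second 0 : CyclicStarVertex m 1 k) ∈ cyclicStarEdge m k x ↔ ∃ b, x = Sum.inl b := by
  cases x <;> simp [cyclicStarEdge, center, second, onCycle, onPendant]

lemma onCycle_mem_cyclicStarEdge {x : Fin 2 ⊕ Fin (m - 2 * 1)} {b : Fin 2} {j : Fin (k - 2)} :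
    (onCycle 0 b j : CyclicStarVertex m 1 k) ∈ cyclicStarEdge m k x ↔ x = Sum.inl b := by
  cases x <;> simp [cyclicStarEdge, center, second, onCycle, onPendant]

lemma onPendant_mem_cyclicStarEdge {x : Fin 2 ⊕ Fin (m - 2 * 1)} {i : Fin (m - 2 * 1)}
    {j : Fin (k - 1)} :
    (onPendant i j : CyclicStarVertex m 1 k) ∈ cyclicStarEdge m k x ↔ x = Sum.inr i := by
  cases x <;> simp [cyclicStarEdge, center, second, onCycle, onPendant]

/-- Every edge has a vertex of its own; on the two cycle edges this needs k ≥ 3. -/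
lemma cyclicStarEdge_injective (hk : 3 ≤ k) : Function.Injective (cyclicStarEdge m k) := by
  rintro (b | i) y h
  · have h1 : (onCycle 0 b ⟨0, by omega⟩ : CyclicStarVertex m 1 k) ∈ cyclicStarEdge m k (Sum.inl b) :=
      onCycle_mem_cyclicStarEdge.mpr rfl
    rw [h] at h1
    exact (onCycle_mem_cyclicStarEdge.mp h1).symm
  · have h1 : (onPendant i ⟨0, by omega⟩ : CyclicStarVertex m 1 k) ∈
        cyclicStarEdge m k (Sum.inr i) := onPendant_mem_cyclicStarEdge.mpr rfl
    rw [h] at h1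
    exact (onPendant_mem_cyclicStarEdge.mp h1).symm

lemma cyclicStar_isUniform (hk : 3 ≤ k) : (cyclicStar m 1 k).IsUniform k := by
  intro e he
  rw [cyclicStar_edgeSet] at he
  obtain ⟨b | i, rfl⟩ := he
  · rw [cyclicStarEdge, Set.ncard_union_eq, Set.ncard_pair, ← Set.image_univ,
      Set.ncard_image_of_injective, Set.ncard_univ, Nat.card_fin]
    · omega
    · intro j j' h; simpa [onCycle] using h
    · simp [center, second]
    · rw [Set.disjoint_left]
      rintro x (rfl | rfl) ⟨j, hj⟩ <;> simp [center, second, onCycle] at hj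
  · rw [cyclicStarEdge, Set.ncard_union_eq, Set.ncard_singleton, ← Set.image_univ,
      Set.ncard_image_of_injective, Set.ncard_univ, Nat.card_fin]
    · omega
    · intro j j' h; simpa [onPendant] using h
    · rw [Set.disjoint_left]
      rintro x rfl ⟨j, hj⟩
      simp [center, onPendant] at hj

lemma cyclicStar_ncard (hk : 3 ≤ k) (hm : 2 ≤ m) : (cyclicStar m 1 k).edgeSet.ncard = m := by
  rw [cyclicStar_edgeSet, ← Set.image_univ,
    Set.ncard_image_of_injective _ (cyclicStarEdge_injective hk), Set.ncard_univ, Nat.card_sum,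
    Nat.card_fin, Nat.card_fin]
  omega

lemma cyclicStar_cyclicStarAt (hk : 3 ≤ k) :
    CyclicStarAt (cyclicStar m 1 k).ends ⟨center, trivial⟩ ⟨second 0, trivial⟩ := by
  have hE (x) : cyclicStarEdge m k x ∈ (cyclicStar m 1 k).edgeSet := by
    rw [cyclicStar_edgeSet]; exact ⟨x, rfl⟩
  have hsurj (e : (cyclicStar m 1 k).edgeSet) : ∃ x, e = ⟨_, hE x⟩ := by
    obtain ⟨e, he⟩ := e
    have he' := he
    rw [cyclicStar_edgeSet] at he'
    obtain ⟨x, rfl⟩ := he'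
    exact ⟨x, rfl⟩
  have hinj (x y) : (⟨_, hE x⟩ : (cyclicStar m 1 k).edgeSet) = ⟨_, hE y⟩ ↔ x = y :=
    ⟨fun h => cyclicStarEdge_injective hk (congrArg Subtype.val h), fun h => by rw [h]⟩
  refine ⟨fun h => ?_, fun e => ?_, ⟨⟨_, hE (Sum.inl 0)⟩, ⟨_, hE (Sum.inl 1)⟩, ?_, fun e => ?_⟩, ?_⟩
  · cases congrArg Subtype.val h
  · obtain ⟨x, rfl⟩ := hsurj e
    refine (mem_ends _).mpr ?_
    cases x
    · exact Or.inl (Or.inl rfl)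
    · exact Or.inl rfl
  · rw [Ne, hinj]; simp
  · obtain ⟨x, rfl⟩ := hsurj e
    rw [mem_ends, hinj, hinj]
    refine second_mem_cyclicStarEdge.trans ⟨?_, ?_⟩
    · rintro ⟨b, rfl⟩
      fin_cases b <;> simp
    · rintro (rfl | rfl)
      · exact ⟨0, rfl⟩
      · exact ⟨1, rfl⟩
  · rintro ⟨⟨⟩ | c | ⟨c, b, j⟩ | ⟨i, j⟩, hv⟩ hw hu
    · exact absurd rfl hw
    · rw [Subsingleton.elim c 0] at hu
      exact absurd rfl hu
    · refine ⟨⟨_, hE (Sum.inl b)⟩, ?_, fun e he => ?_⟩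
      · rw [Subsingleton.elim c 0]
        exact (mem_ends _).mpr (onCycle_mem_cyclicStarEdge.mpr rfl)
      · obtain ⟨x, rfl⟩ := hsurj e
        rw [Subsingleton.elim c 0] at he
        rw [hinj]
        exact onCycle_mem_cyclicStarEdge.mp ((mem_ends _).mp he)
    · refine ⟨⟨_, hE (Sum.inr i)⟩, (mem_ends _).mpr (onPendant_mem_cyclicStarEdge.mpr rfl),
        fun e he => ?_⟩
      obtain ⟨x, rfl⟩ := hsurj e
      rw [hinj]
      exact onPendant_mem_cyclicStarEdge.mp ((mem_ends _).mp he)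

end Concrete

end Hypergraph

namespace Hypergraph

/-! ### Comparison with the extremal hypergraphs -/

section Main

variable {V : Type*} {G : Hypergraph V} [Fintype G.vertexSet] [Fintype G.edgeSet]

-- Since α = (1-α)β, the expression α deg(v) + (1-α)∑b is (1-α)∑(b+β), that is, (1-α)(q+β) = (1-α)q
-- + α.
open Classical in
lemma alphaSpectralRadius_le_of_labels {k : ℕ} (hk : 1 ≤ k) (hG : G.IsUniform k) {α β q : ℝ}
    (hα0 : 0 ≤ α) (hα1 : α < 1) (hβ : α = (1 - α) * β) (hq : 0 < q)
    {b : G.vertexSet → G.edgeSet → ℝ} (hb : ∀ e, ∀ v ∈ G.ends e, 0 < b v e)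
    (hprod : ∀ e, 1 ≤ ∏ v ∈ G.ends e, b v e)
    (hsum : ∀ v, ∑ e with v ∈ G.ends e, (b v e + β) = q + β) :
    G.alphaSpectralRadius k α ≤ (1 - α) * q + α ∧ (G.IsConnected →
      G.alphaSpectralRadius k α = (1 - α) * q + α → ∀ e, ∏ v ∈ G.ends e, b v e = 1) := by
  have hα : 0 < 1 - α := by linarith
  refine alphaSpectralRadius_le hk hG hα0 hα1 hb hprod (by positivity) fun v => le_of_eq ?_
  have h := hsum v
  rw [Finset.sum_add_distrib, Finset.sum_const, nsmul_eq_mul] at h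
  linear_combination (1 - α) * h +
    ((Finset.univ.filter fun e => v ∈ G.ends e).card - 1 : ℝ) * hβ

lemma card_edgeSet {m : ℕ} (h : G.edgeSet.ncard = m) : Fintype.card G.edgeSet = m := by
  rw [← h, ← Nat.card_coe_set_eq, Nat.card_eq_fintype_card]

omit [Fintype G.edgeSet] in
lemma ends_nonempty {k : ℕ} (hk : 1 ≤ k) (hG : G.IsUniform k) (e : G.edgeSet) :
    (G.ends e).Nonempty := Finset.card_pos.mp (by rw [G.card_ends hG]; omega)

omit [Fintype G.edgeSet] in
/-- The hyperstar maximizes the `α`-spectral radius among the hypertrees. -/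
theorem IsHypertree.alphaSpectralRadius_le_hyperstar {k m : ℕ} (hk : 2 ≤ k) (hm : 1 ≤ m) {α : ℝ}
    (hα0 : 0 ≤ α) (hα1 : α < 1) (hG : G.IsUniform k) (hcard : G.edgeSet.ncard = m)
    (h : G.IsHypertree) :
    G.alphaSpectralRadius k α ≤ (hyperstar m k).alphaSpectralRadius k α ∧
      (G.alphaSpectralRadius k α = (hyperstar m k).alphaSpectralRadius k α ↔
        G.Isomorphic (hyperstar m k)) := by
  classical
  have := G.finite_edgeSet.fintype
  have := (hyperstar m k).finite_edgeSet.fintype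
  have hE := card_edgeSet hcard
  have hE' := card_edgeSet (hyperstar_ncard (m := m) hk)
  have hβ0 : 0 ≤ α / (1 - α) := div_nonneg hα0 (by linarith)
  have hβ : α = (1 - α) * (α / (1 - α)) := (mul_div_cancel₀ _ (by linarith)).symm
  -- Any solution serves: the same p and q give the exact value for the hyperstar and the labels on
  -- G, so uniqueness is not needed.
  obtain ⟨p, q, hp, hq0, hq, hpq⟩ := exists_star_root (k - 1) (m := m) (by exact_mod_cast hm) hβ0
  rw [(hyperstar_starAt m k).alphaSpectralRadius_eq hk (hyperstar_isUniform hk) hα0 hα1 hβ hq0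
    (by rw [hE']; exact hq) hpq]
  have hne := ends_nonempty (by omega) hG
  obtain ⟨e₀⟩ : Nonempty G.edgeSet := Fintype.card_pos_iff.mp (by omega)
  obtain ⟨R⟩ := h.exists_edgeRooted hne e₀
  obtain ⟨b, hb, hprod, hsum, htight⟩ := exists_labels_of_tree hk (G.card_ends hG) R hp hβ0
    (by rw [hE]; exact hq) hpq
  obtain ⟨hle, heq⟩ := alphaSpectralRadius_le_of_labels (by omega) hG hα0 hα1 hβ hq0 hb hprod hsum
  refine ⟨hle, fun hρ => ?_, fun hiso => ?_⟩
  · obtain ⟨w, hw1, hw2⟩ := htight (heq h.1 hρ)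
    obtain ⟨φ, ψ, hφ⟩ := StarAt.exists_equiv (G.card_ends hG)
      (card_ends _ (hyperstar_isUniform hk)) (hE.trans hE'.symm) ⟨hw1, hw2⟩ (hyperstar_starAt m k)
    exact Isomorphic.of_equiv φ ψ hφ
  · obtain ⟨φ, ψ, hφ⟩ := hiso.exists_equiv
    exact ((hyperstar_starAt m k).transfer φ ψ hφ).alphaSpectralRadius_eq hk hG hα0 hα1 hβ hq0
      (by rw [hE]; exact hq) hpq

omit [Fintype G.edgeSet] in
/-- The hypergraph `H_{m,1,k}` maximizes the `α`-spectral radius among the unicyclic hypergraphs. -/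
theorem IsUnicyclic.alphaSpectralRadius_le_cyclicStar {k m : ℕ} (hk : 3 ≤ k) (hm : 2 ≤ m) {α : ℝ}
    (hα0 : 0 ≤ α) (hα1 : α < 1) (hG : G.IsUniform k) (hcard : G.edgeSet.ncard = m)
    (h : G.IsUnicyclic) :
    G.alphaSpectralRadius k α ≤ (cyclicStar m 1 k).alphaSpectralRadius k α ∧
      (G.alphaSpectralRadius k α = (cyclicStar m 1 k).alphaSpectralRadius k α ↔
        G.Isomorphic (cyclicStar m 1 k)) := by
  classical
  have := G.finite_edgeSet.fintype
  have := (cyclicStar m 1 k).finite_edgeSet.fintype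
  have hE := card_edgeSet hcard
  have hE' := card_edgeSet (cyclicStar_ncard hk hm)
  have hβ0 : 0 ≤ α / (1 - α) := div_nonneg hα0 (by linarith)
  have hβ : α = (1 - α) * (α / (1 - α)) := (mul_div_cancel₀ _ (by linarith)).symm
  obtain ⟨p, q, θ, hp, hq0, hθ0, hθ, hq, hpq⟩ :=
    exists_cyclicStar_root hk (m := m) (by exact_mod_cast hm) hβ0
  rw [(cyclicStar_cyclicStarAt hk).alphaSpectralRadius_eq hk (cyclicStar_isUniform hk) hα0 hα1 hβ
    hq0 hθ0 hθ (by rw [hE']; exact hq) hpq]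
  obtain ⟨e₀, v₁, hv₁, ⟨R⟩⟩ := h.exists_edgeRooted (ends_nonempty (by omega) hG)
  -- The label p' of the centre on a cycle edge is p θ^k.
  have hpq' : p * θ ^ k * (q - α / (1 - α)) * q ^ (k - 2) = 2 := by
    have h1 : p * (q ^ (k - 2) * q) = 1 := by
      rw [← pow_succ, show k - 2 + 1 = k - 1 by omega, hpq]
    linear_combination p * q ^ (k - 2) * hθ + 2 * h1
  obtain ⟨b, hb, hprod, hsum, htight⟩ := exists_labels_of_unicyclic hk (G.card_ends hG) hv₁ R hp
    (by positivity : 0 < p * θ ^ k) hβ0 (by rw [hE]; exact hq) hpq hpq'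
  obtain ⟨hle, heq⟩ := alphaSpectralRadius_le_of_labels (by omega) hG hα0 hα1 hβ hq0 hb hprod hsum
  refine ⟨hle, fun hρ => ?_, fun hiso => ?_⟩
  · obtain ⟨w, u, hw⟩ := htight (heq h.1 hρ)
    obtain ⟨φ, ψ, hφ⟩ := CyclicStarAt.exists_equiv (G.card_ends hG)
      (card_ends _ (cyclicStar_isUniform hk)) (hE.trans hE'.symm) hw (cyclicStar_cyclicStarAt hk)
    exact Isomorphic.of_equiv φ ψ hφ
  · obtain ⟨φ, ψ, hφ⟩ := hiso.exists_equiv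
    exact ((cyclicStar_cyclicStarAt hk).transfer φ ψ hφ).alphaSpectralRadius_eq hk hG hα0 hα1 hβ
      hq0 hθ0 hθ (by rw [hE]; exact hq) hpq

end Main

end Hypergraph
theorem mainTheorem4 (k : ℕ) (hk : 2 ≤ k) (α : ℝ) (hα0 : 0 ≤ α) (hα1 : α < 1) (m : ℕ) :
    (1 ≤ m →
      ((Hypergraph.hyperstar m k).IsUniform k ∧
        (Hypergraph.hyperstar m k).edgeSet.ncard = m ∧
        (Hypergraph.hyperstar m k).IsHypertree) ∧
      ∀ (V : Type*) (G : Hypergraph V) [Fintype G.vertexSet],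
        G.IsUniform k → G.edgeSet.ncard = m → G.IsHypertree →
          G.alphaSpectralRadius k α ≤ (Hypergraph.hyperstar m k).alphaSpectralRadius k α ∧
          (G.alphaSpectralRadius k α = (Hypergraph.hyperstar m k).alphaSpectralRadius k α ↔
            G.Isomorphic (Hypergraph.hyperstar m k))) ∧
    (3 ≤ k → 2 ≤ m →
      ((Hypergraph.cyclicStar m 1 k).IsUniform k ∧
        (Hypergraph.cyclicStar m 1 k).edgeSet.ncard = m ∧
        (Hypergraph.cyclicStar m 1 k).IsUnicyclic) ∧
      ∀ (V : Type*) (G : Hypergraph V) [Fintype G.vertexSet],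
        G.IsUniform k → G.edgeSet.ncard = m → G.IsUnicyclic →
          G.alphaSpectralRadius k α ≤ (Hypergraph.cyclicStar m 1 k).alphaSpectralRadius k α ∧
          (G.alphaSpectralRadius k α = (Hypergraph.cyclicStar m 1 k).alphaSpectralRadius k α ↔
            G.Isomorphic (Hypergraph.cyclicStar m 1 k))) := by
  refine ⟨fun hm => ⟨⟨Hypergraph.hyperstar_isUniform hk, Hypergraph.hyperstar_ncard hk,
    (Hypergraph.hyperstar_starAt m k).isHypertree⟩, fun V G _ hG hcard h =>
      h.alphaSpectralRadius_le_hyperstar hk hm hα0 hα1 hG hcard⟩, fun hk3 hm =>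
    ⟨⟨Hypergraph.cyclicStar_isUniform hk3, Hypergraph.cyclicStar_ncard hk3 hm,
      (Hypergraph.cyclicStar_cyclicStarAt hk3).isUnicyclic⟩, fun V G _ hG hcard h =>
      h.alphaSpectralRadius_le_cyclicStar hk3 hm hα0 hα1 hG hcard⟩⟩
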